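/- Identify $\mathbb{N}$ with $\{0,1\}^*$ by the length-lexicographic correspondence $\varepsilon\leftrightarrow 0,\ 0\leftrightarrow 1,\ 1\leftrightarrow 2,\ 00\leftrightarrow 3,\dots$, let $l(p)$ be the length of the string $p$, let $\bot$ be a special symbol ("don't know"), let $\chi_A$ be the characteristic function of $A$ with values the one-bit strings $0,1$, and let $W_e$ be the domain of the $e$-th partial recursive function. For a partial recursive $U:\{0,1\}^*\times\{0,1\}^*\to\{0,1\}^*\cup\{\bot\}$, $x\in\{0,1\}^*$ and $A\subseteq\{0,1\}^*$ put (with $\min\emptyset=\infty$) - $C_U(x)=\min\{l(p): U(p,\varepsilon)=x\}$; - $\overline{ic}_U(x:A)=\min\{l(p): U(p,x)=\chi_A(x)$, and $U(p,z)\in\{\chi_A(z),\bot\}$ for every $z$ for which $U(p,z)$ is defined$\}$; - $ic_U(x:A)$, the same minimum taken only over those $p$ for which in addition $U(p,z)$ is defined for all $z$. $U$ is *optimal* if it is partial recursive and for every partial recursive $U'$ there is a constant $c$ with $C_U(x)\le C_{U'}(x)+c$, $ic_U(x:A)\le ic_{U'}(x:A)+c$ and $\overline{ic}_U(x:A)\le\overline{ic}_{U'}(x:A)+c$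 for all $x$ and $A$. The set $A$ has *hard instances* (with respect to $U$) if there is a constant $c$ with $ic_U(x:A)\ge C_U(x)-c$ for infinitely many $x$; it has hard instances *with respect to $\overline{ic}$* if the same holds with $\overline{ic}_U$ in place of $ic_U$. A set $A\subseteq\mathbb{N}$ is *hyperhypersimple* if it is r.e., its complement is infinite, and there is no recursive $f$ such that the sets $W_{f(0)},W_{f(1)},\dots$ are finite, pairwise disjoint and all meet the complement of $A$. A set $A$ is *Q-complete* if it is r.e. and there is a recursive $g$ such that for all $x$: $x\in K\Leftrightarrow W_{g(x)}\subseteq A$, where $K=\{x: x\in W_x\}$. **Theorem.** Let $U$ be an optimal partial recursive function and let $A$ be a hyperhypersimple set. Then $A$ has hard instances with respect to $\overline{ic}$, and hence $A$ has hard instances (with respect to $ic$). Moreover, $A$ is not Q-complete. -/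

import Mathlib

/-- The canonical correspondence between binary strings and natural numbers:
`ε ↦ 0, 0 ↦ 1, 1 ↦ 2, 00 ↦ 3, 01 ↦ 4, …`, that is, `w` goes to
(the number with binary expansion `1w`) minus one.  The first bit of `w` is the head of the list. -/
def strNat (w : List Bool) : ℕ :=
  w.foldl (fun n b => 2 * n + 1 + b.toNat) 0

theorem strNat_append_singleton (w : List Bool) (b : Bool) :
    strNat (w ++ [b]) = 2 * strNat w + 1 + b.toNat := by
  simp [strNat]

theorem strNat_bijective : Function.Bijective strNat := by
  constructor
  · intro v
    induction v using List.reverseRecOn with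
    | nil =>
      intro w h
      induction w using List.reverseRecOn with
      | nil => rfl
      | append_singleton w b _ =>
        rw [strNat_append_singleton] at h
        change 0 = _ at h
        omega
    | append_singleton v a ih =>
      intro w h
      induction w using List.reverseRecOn with
      | nil =>
        rw [strNat_append_singleton] at h
        change _ = 0 at h
        omega
      | append_singleton w b _ =>
        rw [strNat_append_singleton, strNat_append_singleton] at h
        have hab : a = b ∧ strNat v = strNat w := by
          cases a <;> cases b <;> simp at h ⊢ <;> omega
        rw [hab.1, ih hab.2]
  · intro n
    induction n using Nat.strong_induction_on with
    | _ n ih =>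
      rcases Nat.eq_zero_or_pos n with h0 | h0
      · exact ⟨[], by simp [strNat, h0]⟩
      · obtain ⟨w, hw⟩ := ih ((n - 1) / 2) (by omega)
        rcases Nat.mod_two_eq_zero_or_one (n - 1) with h | h
        · refine ⟨w ++ [false], ?_⟩
          rw [strNat_append_singleton, hw, Bool.toNat_false]
          omega
        · refine ⟨w ++ [true], ?_⟩
          rw [strNat_append_singleton, hw, Bool.toNat_true]
          omega

/-- Interpreters: partial maps from (program, input) to a string (`some v`) or to the
"don't know" symbol `⊥` (`none`).  Divergence is expressed by `Part`. -/
abbrev Interp : Type := List Bool → List Bool →. Option (List Bool)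

/-- The Kolmogorov complexity `C_U(x)` (`⊤` if there is no program for `x`). -/
noncomputable def kolmogorov (U : Interp) (x : List Bool) : ℕ∞ :=
  ⨅ (p : List Bool) (_ : some x ∈ U p []), (p.length : ℕ∞)

open Classical in
/-- The characteristic function of `A`, with values the one-bit strings `0` and `1`. -/
noncomputable def charStr (A : Set (List Bool)) (x : List Bool) : List Bool :=
  if x ∈ A then [true] else [false]

/-- A partial function is `A`-consistent if on its domain it returns `χ_A(x)` or `⊥`. -/
def AConsistent (A : Set (List Bool)) (f : List Bool →. Option (List Bool)) : Prop :=
  ∀ x, ∀ v ∈ f x, v = some (charStr A x) ∨ v = none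

/-- The instance complexity `ic_U(x : A)`: total `A`-consistent programs deciding `x`. -/
noncomputable def instComplexity (U : Interp) (A : Set (List Bool)) (x : List Bool) : ℕ∞ :=
  ⨅ (p : List Bool)
    (_ : (∀ z, (U p z).Dom) ∧ AConsistent A (U p) ∧ some (charStr A x) ∈ U p x),
    (p.length : ℕ∞)

/-- The weak instance complexity `ic̄_U(x : A)`: the programs need not be total. -/
noncomputable def weakInstComplexity (U : Interp) (A : Set (List Bool)) (x : List Bool) : ℕ∞ :=
  ⨅ (p : List Bool) (_ : AConsistent A (U p) ∧ some (charStr A x) ∈ U p x), (p.length : ℕ∞)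

/-- Optimal partial recursive interpreters. -/
def IsOptimal (U : Interp) : Prop :=
  Partrec₂ U ∧ ∀ U' : Interp, Partrec₂ U' → ∃ c : ℕ,
    (∀ x, kolmogorov U x ≤ kolmogorov U' x + c) ∧
    (∀ A x, instComplexity U A x ≤ instComplexity U' A x + c) ∧
    (∀ A x, weakInstComplexity U A x ≤ weakInstComplexity U' A x + c)

/-- `A` has hard instances: for some `c`, `ic(x : A) ≥ C(x) - c` for infinitely many `x`. -/
def HasHardInstances (U : Interp) (A : Set (List Bool)) : Prop :=
  ∃ c : ℕ, {x | kolmogorov U x ≤ instComplexity U A x + c}.Infinite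

/-- `A` has hard instances with respect to `ic̄`. -/
def HasWeakHardInstances (U : Interp) (A : Set (List Bool)) : Prop :=
  ∃ c : ℕ, {x | kolmogorov U x ≤ weakInstComplexity U A x + c}.Infinite

/-- The `e`-th recursively enumerable set `W_e`, the domain of the `e`-th partial recursive
function. -/
def reSet (e : ℕ) : Set ℕ :=
  {x | ((Denumerable.ofNat Nat.Partrec.Code e).eval x).Dom}

/-- The halting set `K = {x : x ∈ W_x}`. -/
def haltingSet : Set ℕ := {x | x ∈ reSet x}

/-- `A` is hyperhypersimple: r.e., coinfinite, and no weak array (a uniformly r.e. sequence of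
finite sets) which is pairwise disjoint has all its members meeting the complement of `A`. -/
def IsHyperhypersimple (A : Set ℕ) : Prop :=
  REPred (fun x => x ∈ A) ∧ Aᶜ.Infinite ∧
    ¬ ∃ f : ℕ → ℕ, Computable f ∧ (∀ n, (reSet (f n)).Finite) ∧
      (∀ m n, m ≠ n → Disjoint (reSet (f m)) (reSet (f n))) ∧
      ∀ n, (reSet (f n) ∩ Aᶜ).Nonempty

/-- `A` is Q-complete: r.e., with a recursive `g` such that `x ∈ K ↔ W_{g(x)} ⊆ A`. -/
def IsQComplete (A : Set ℕ) : Prop :=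
  REPred (fun x => x ∈ A) ∧
    ∃ g : ℕ → ℕ, Computable g ∧ ∀ x, x ∈ haltingSet ↔ reSet (g x) ⊆ A

open Filter

/-! ### Computability preliminaries -/

section
variable {α : Type*} [Primcodable α]

/-! Hard instances. Suppose that almost every x has weak instance complexity far below its
Kolmogorov complexity. Level n holds the numbers rejected by a program of length at most 2n not yet
seen to reject an element of A. Whatever stays in a level lies outside A, and almost every element
outside A stays in some level. Each level has a threshold, raised above all current elements when
one of its programs is refuted or a lower level gets an element above its own threshold. Each
threshold is raised finitely often. If almost all levels end up above their thresholds, the elements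
appearing there while the lower levels (from some k₀ on) are above theirs form a disjoint weak array
meeting the complement of A (`LevelSystem.not_firstFound_of_lt`,
`LevelSystem.exists_firstFound_lasting`).

That levels get above their thresholds is forced by selecting at most 4^(n+4) elements of level n+1
(`LevelSystem.length_selected_le`). They have complexity at most 2n + O(1), so by assumption a
lasting one, with finitely many exceptions, lies already in level n. Selections are made where the
number of exceeded thresholds fails to grow, so it must grow
(`LevelSystem.exists_forall_eventually_found`).

Q-completeness. By the recursion theorem, each attempt a has an index that enters K exactly when a
is cancelled. Cancelling a thus forces its set, given by the reduction, into A; if a is never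
cancelled, the set has an element outside A. Column n uses its attempts to enumerate an element
outside A. When a candidate already belongs to another column, the attempt of the higher column is
cancelled, which forces the candidate into A. Induction on n (`columnSucceeds`) shows that all
columns succeed, and they form a forbidden weak array. -/

theorem PrimrecPred.exists_lt_of {R : α → ℕ → Prop} {b : α → ℕ} (hb : Primrec b)
    (hR : PrimrecPred fun q : α × ℕ => R q.1 q.2) : PrimrecPred fun a => ∃ x < b a, R a x := by
  have h : PrimrecRel fun (L : List ℕ) (a : α) => ∃ x ∈ L, R a x :=
    PrimrecRel.exists_mem_list (R := fun x a => R a x) (hR.comp (Primrec.pair .snd .fst))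
  exact (h.comp (Primrec.list_range.comp hb) .id).of_eq fun a => by simp

theorem PrimrecPred.forall_lt_of {R : α → ℕ → Prop} {b : α → ℕ} (hb : Primrec b)
    (hR : PrimrecPred fun q : α × ℕ => R q.1 q.2) : PrimrecPred fun a => ∀ x < b a, R a x := by
  have h : PrimrecRel fun (L : List ℕ) (a : α) => ∀ x ∈ L, R a x :=
    PrimrecRel.forall_mem_list (R := fun x a => R a x) (hR.comp (Primrec.pair .snd .fst))
  exact (h.comp (Primrec.list_range.comp hb) .id).of_eq fun a => by simp

theorem Primrec.nat_count {R : α → ℕ → Prop} [∀ a, DecidablePred (R a)] {b : α → ℕ}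
    (hb : Primrec b) (hR : PrimrecPred fun q : α × ℕ => R q.1 q.2) :
    Primrec fun a => Nat.count (R a) (b a) := by
  classical
  have h : Primrec fun a => (Nat.rec 0 (fun n c => c + if R a n then 1 else 0) (b a) : ℕ) :=
    Primrec.nat_rec' hb (.const 0) (Primrec.nat_add.comp (Primrec.snd.comp .snd)
      (Primrec.ite (hR.comp (Primrec.pair .fst (Primrec.fst.comp .snd))) (.const 1)
        (.const 0))).to₂
  refine h.of_eq fun a => ?_
  induction b a with
  | zero => rfl
  | succ n ih => rw [Nat.count_succ, ← ih]

theorem Primrec.two_pow {b : α → ℕ} (hb : Primrec b) :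
    Primrec fun a => 2 ^ b a := by
  have h : Primrec fun a => (Nat.rec 1 (fun _ c => c * 2) (b a) : ℕ) :=
    Primrec.nat_rec' hb (.const 1)
      (Primrec.nat_mul.comp (Primrec.snd.comp .snd) (.const 2)).to₂
  refine h.of_eq fun a => ?_
  induction b a with
  | zero => rfl
  | succ n ih => rw [pow_succ, ← ih]

theorem Primrec.four_pow {b : α → ℕ} (hb : Primrec b) : Primrec fun a => 4 ^ b a := by
  have h : Primrec fun a => (Nat.rec 1 (fun _ c => c * 4) (b a) : ℕ) :=
    Primrec.nat_rec' hb (.const 1) 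
      (Primrec.nat_mul.comp (Primrec.snd.comp .snd) (.const 4)).to₂
  refine h.of_eq fun a => ?_
  induction b a with
  | zero => rfl
  | succ n ih => rw [pow_succ, ← ih]

theorem Nat.Partrec.Code.primrecPred_evaln_isSome (c : Nat.Partrec.Code) :
    PrimrecPred fun q : ℕ × ℕ => (c.evaln q.1 q.2).isSome = true :=
  Primrec.eq.comp (Primrec.option_isSome.comp (primrec_evaln.comp
    ((Primrec.fst.pair (.const c)).pair .snd))) (.const true)

end

theorem Nat.Partrec.Code.eval_dom_iff {c : Nat.Partrec.Code} {n : ℕ} :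
    (c.eval n).Dom ↔ ∃ s, (c.evaln s n).isSome := by
  rw [Part.dom_iff_mem]
  simp only [evaln_complete, Option.isSome_iff_exists, Option.mem_def]
  exact exists_comm

theorem Nat.Partrec.Code.evaln_isSome_mono {c : Nat.Partrec.Code} {s t n : ℕ} (hst : s ≤ t)
    (h : (c.evaln s n).isSome) : (c.evaln t n).isSome := by
  obtain ⟨v, hv⟩ := Option.isSome_iff_exists.1 h
  exact Option.isSome_iff_exists.2 ⟨v, evaln_mono hst hv⟩

theorem REPred.exists_code_dom {A : Set ℕ} (hA : REPred fun x => x ∈ A) :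
    ∃ c : Nat.Partrec.Code, ∀ x, x ∈ A ↔ (c.eval x).Dom := by
  have h : Partrec fun x : ℕ => (Part.assert (x ∈ A) fun _ => Part.some ()).map fun _ => 0 :=
    Partrec.map hA (Computable.const 0).to₂
  obtain ⟨c, hc⟩ := Nat.Partrec.Code.exists_code.1 (Partrec.nat_iff.1 h)
  refine ⟨c, fun x => ?_⟩
  rw [hc, Part.map_Dom]
  exact ⟨fun h => ⟨h, trivial⟩, fun h => h.1⟩

theorem mem_reSet_encode {c : Nat.Partrec.Code} {x : ℕ} :
    x ∈ reSet (Encodable.encode c) ↔ (c.eval x).Dom := by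
  simp [reSet]

/-- A uniformly enumerated sequence of finite pairwise disjoint sets meeting the complement of `A`
refutes hyperhypersimplicity. -/
theorem not_isHyperhypersimple_of_enumeration {A : Set ℕ} {R : ℕ → ℕ → ℕ → Prop}
    (hR : PrimrecPred fun q : ℕ × ℕ × ℕ => R q.1 q.2.1 q.2.2)
    (hfin : ∀ k, {x | ∃ t, R k t x}.Finite)
    (hdisj : ∀ j k t t' x, j < k → R j t x → R k t' x → False)
    (hmeet : ∀ k, ∃ x ∉ A, ∃ t, R k t x) : ¬ IsHyperhypersimple A := by
  classical
  rintro ⟨-, -, hno⟩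
  -- The search halts on the pair of k and x exactly when x enters the k-th set, so currying at k
  -- yields an index of that set.
  have hpart : Partrec fun n : ℕ =>
      Nat.rfind fun t => Part.some (decide (R n.unpair.1 t n.unpair.2)) := by
    refine Partrec.rfind (p := fun (n : ℕ) t => Part.some (decide (R n.unpair.1 t n.unpair.2))) ?_
    refine Computable₂.partrec₂ (Primrec.to_comp ?_)
    exact (hR.comp (Primrec.pair (Primrec.fst.comp (Primrec.unpair.comp .fst))
      (Primrec.pair .snd (Primrec.snd.comp (Primrec.unpair.comp .fst))))).decide
  obtain ⟨c, hc⟩ := Nat.Partrec.Code.exists_code.1 (Partrec.nat_iff.1 hpart)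
  have hset : ∀ k, reSet (Encodable.encode (c.curry k)) = {x | ∃ t, R k t x} := by
    intro k
    ext x
    rw [mem_reSet_encode, Nat.Partrec.Code.eval_curry, hc]
    simp only [Nat.unpair_pair, Set.mem_ofPred_eq]
    constructor
    · intro h
      exact ⟨_, by simpa using Nat.rfind_spec (Part.get_mem h)⟩
    · rintro ⟨t, ht⟩
      exact Nat.rfind_dom.2 ⟨t, by simpa using ht, fun _ => trivial⟩
  refine hno ⟨fun k => Encodable.encode (c.curry k), ?_, ?_, ?_, ?_⟩
  · exact (Primrec.encode.comp
      (Nat.Partrec.Code.primrec₂_curry.comp (.const c) .id)).to_comp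
  · intro k; rw [hset]; exact hfin k
  · intro j k hjk
    rw [hset, hset, Set.disjoint_left]
    rintro x ⟨t, ht⟩ ⟨t', ht'⟩
    rcases lt_or_gt_of_ne hjk with h | h
    · exact hdisj _ _ _ _ _ h ht ht'
    · exact hdisj _ _ _ _ _ h ht' ht
  · intro k
    rw [hset]
    obtain ⟨x, hx, ht⟩ := hmeet k
    exact ⟨x, ht, hx⟩

/-! ### Strings and numbers -/

theorem primrec_strNat : Primrec strNat := by
  refine (Primrec.list_foldl (f := fun w : List Bool => w) (g := fun _ => (0 : ℕ))
    (h := fun (_ : List Bool) (q : ℕ × Bool) => 2 * q.1 + 1 + q.2.toNat) .id (.const 0) ?_)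
  have hb : Primrec fun b : Bool => b.toNat := Primrec.dom_finite _
  exact Primrec.nat_add.comp (Primrec.succ.comp (Primrec.nat_mul.comp (.const 2)
    (Primrec.fst.comp .snd))) (hb.comp (Primrec.snd.comp .snd))

/-- The string with a given number. -/
noncomputable def natStr (n : ℕ) : List Bool := (Equiv.ofBijective strNat strNat_bijective).symm n

@[simp] theorem strNat_natStr (n : ℕ) : strNat (natStr n) = n :=
  (Equiv.ofBijective strNat strNat_bijective).apply_symm_apply n

@[simp] theorem natStr_strNat (w : List Bool) : natStr (strNat w) = w :=
  (Equiv.ofBijective strNat strNat_bijective).symm_apply_apply w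

theorem computable_natStr : Computable natStr := by
  have h : Partrec fun n : ℕ => Nat.rfindOpt fun m =>
      (Encodable.decode (α := List Bool) m).bind fun w => if strNat w = n then some w else none := by
    refine Partrec.rfindOpt (Primrec.to_comp (Primrec.option_bind
      (Primrec.decode.comp .snd) ?_))
    exact Primrec.ite (Primrec.eq.comp (primrec_strNat.comp .snd) (Primrec.fst.comp .fst))
      (Primrec.option_some.comp .snd) (.const none)
  refine h.of_eq_tot fun n => ?_
  have hdom : (Nat.rfindOpt fun m => (Encodable.decode (α := List Bool) m).bind fun w =>
      if strNat w = n then some w else none).Dom :=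
    Nat.rfindOpt_dom.2 ⟨Encodable.encode (natStr n), natStr n, by simp⟩
  obtain ⟨m, hm⟩ := Nat.rfindOpt_spec (Part.get_mem hdom)
  rw [Option.mem_def, Option.bind_eq_some_iff] at hm
  obtain ⟨w, -, hw⟩ := hm
  have h2 : strNat w = n ∧ w = (Nat.rfindOpt fun m => (Encodable.decode (α := List Bool) m).bind
      fun w => if strNat w = n then some w else none).get hdom := by simpa using hw
  have h3 := Part.get_mem hdom
  rw [← h2.2] at h3
  rwa [show natStr n = w by rw [← h2.1, natStr_strNat]]

theorem strNat_bounds (w : List Bool) :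
    2 ^ w.length ≤ strNat w + 1 ∧ strNat w + 1 < 2 ^ (w.length + 1) := by
  induction w using List.reverseRecOn with
  | nil => simp [strNat]
  | append_singleton w b ih =>
    rw [strNat_append_singleton, List.length_append, List.length_singleton]
    have := b.toNat_le
    rw [pow_succ] at ih
    rw [pow_succ, pow_succ]
    omega

theorem length_le_of_strNat_lt {w : List Bool} {l : ℕ} (h : strNat w + 1 < 2 ^ (l + 1)) :
    w.length ≤ l := by
  have h1 := (strNat_bounds w).1.trans_lt h
  have := (Nat.pow_lt_pow_iff_right (a := 2) (by norm_num)).1 h1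
  omega

theorem strNat_lt_of_length_le {w : List Bool} {n : ℕ} (h : w.length ≤ 2 * n) :
    strNat w < 2 * 4 ^ n := by
  have h1 := (strNat_bounds w).2
  have h2 : 2 ^ (w.length + 1) ≤ 2 ^ (2 * n + 1) := Nat.pow_le_pow_right (by norm_num) (by omega)
  rw [pow_succ 2 (2 * n), pow_mul] at h2
  norm_num at h2
  omega

/-- The strings of length l have the consecutive numbers from 2^l - 1 on. -/
theorem exists_length_strNat {l i : ℕ} (hi : i < 2 ^ l) :
    ∃ w : List Bool, w.length = l ∧ strNat w + 1 - 2 ^ w.length = i := by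
  have hs : strNat (natStr (2 ^ l + i - 1)) = 2 ^ l + i - 1 := strNat_natStr _
  have hpos : 0 < 2 ^ l := by positivity
  have hb := strNat_bounds (natStr (2 ^ l + i - 1))
  have h1 : (natStr (2 ^ l + i - 1)).length ≤ l :=
    length_le_of_strNat_lt (by rw [hs, pow_succ]; omega)
  have h2 : l < (natStr (2 ^ l + i - 1)).length + 1 := by
    refine (Nat.pow_lt_pow_iff_right (a := 2) (by norm_num)).1 (lt_of_le_of_lt ?_ hb.2)
    omega
  have h3 : (natStr (2 ^ l + i - 1)).length = l := by omega
  exact ⟨natStr (2 ^ l + i - 1), h3, by rw [h3, hs]; omega⟩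

/-! ### Thresholds and selections for a system of levels -/

/-- `K n x t` says that `x` is in level `n` at stage `t`; `D n t` says that level `n` may lose
elements at stage `t`. -/
structure LevelSystem (K : ℕ → ℕ → ℕ → Prop) (D : ℕ → ℕ → Prop) : Prop where
  lt : ∀ {n x t}, K n x t → x < t
  mono : ∀ {m n x t}, m ≤ n → K m x t → K n x t
  persist : ∀ {n x t}, ¬ D n t → K n x t → K n x (t + 1)
  die_mono : ∀ {m n t}, m ≤ n → D m t → D n t
  die_count : ∀ n s, (open Classical in Nat.count (D n) s) ≤ 2 * 4 ^ n

/-- Level `n` has an element above `θ` at stage `t`. -/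
def FoundAbove (K : ℕ → ℕ → ℕ → Prop) (θ t n : ℕ) : Prop :=
  ∃ x < t, θ ≤ x ∧ K n x t

/-- The condition under which the `k`-th threshold is reset at stage `t`. -/
def ResetStep (K : ℕ → ℕ → ℕ → Prop) (D : ℕ → ℕ → Prop) (t k : ℕ) (θ : ℕ → ℕ) : Prop :=
  D k t ∨ ∃ j < k, ¬ FoundAbove K (θ j) t j ∧ FoundAbove K (θ j) (t + 1) j

open Classical in
/-- The `k`-th threshold at stage `t`. -/
noncomputable def threshold (K : ℕ → ℕ → ℕ → Prop) (D : ℕ → ℕ → Prop) : ℕ → ℕ → ℕ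
  | 0 => fun _ => 0
  | t + 1 => fun k => if ResetStep K D t k (threshold K D t) then t + 1 else threshold K D t k

/-- The `k`-th threshold is reset at stage `t`. -/
def Reset (K : ℕ → ℕ → ℕ → Prop) (D : ℕ → ℕ → Prop) (t k : ℕ) : Prop :=
  ResetStep K D t k (threshold K D t)

/-- Level `k` has an element above its own threshold. -/
def Found (K : ℕ → ℕ → ℕ → Prop) (D : ℕ → ℕ → Prop) (t k : ℕ) : Prop :=
  FoundAbove K (threshold K D t k) t k

open Classical in
/-- The number of thresholds of index at most `n` exceeded by level `n`. -/
noncomputable def exceeded (K : ℕ → ℕ → ℕ → Prop) (D : ℕ → ℕ → Prop) (t n : ℕ) : ℕ :=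
  Nat.count (fun k => FoundAbove K (threshold K D t k) t n) (n + 1)

/-- The largest function below `exceeded` which grows by at most two at each level. -/
noncomputable def tamed (K : ℕ → ℕ → ℕ → Prop) (D : ℕ → ℕ → Prop) (t : ℕ) : ℕ → ℕ
  | 0 => exceeded K D t 0
  | n + 1 => min (exceeded K D t (n + 1)) (tamed K D t n + 2)

/-- The condition for selecting an element of level `n + 1` at stage `t`. -/
def SelectCond (K : ℕ → ℕ → ℕ → Prop) (D : ℕ → ℕ → Prop) (n t : ℕ) (L : List ℕ) : Prop :=
  exceeded K D t n = tamed K D t n ∧ tamed K D t n ≤ n ∧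
    FoundAbove K (threshold K D t (tamed K D t n)) t (n + 1) ∧
    ∀ x ∈ L, ¬ (threshold K D t (tamed K D t n) ≤ x ∧ K (n + 1) x t)

open Classical in
/-- The elements of level `n + 1` selected before stage `t`. -/
noncomputable def selected (K : ℕ → ℕ → ℕ → Prop) (D : ℕ → ℕ → Prop) (n : ℕ) : ℕ → List ℕ
  | 0 => []
  | t + 1 =>
    if SelectCond K D n t (selected K D n t) then
      selected K D n t ++ [Nat.findGreatest (fun x => K (n + 1) x t) t]
    else selected K D n t

/-! ### Counting and eventual constancy -/

theorem exists_step_of_le {p : ℕ → Prop} {s t : ℕ} (hst : s ≤ t) (hs : ¬ p s) (ht : p t) :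
    ∃ u, s ≤ u ∧ u < t ∧ ¬ p u ∧ p (u + 1) := by
  induction t, hst using Nat.le_induction with
  | base => exact absurd ht hs
  | succ t h ih =>
    by_cases hp : p t
    · obtain ⟨u, h1, h2, h3⟩ := ih hp
      exact ⟨u, h1, by omega, h3⟩
    · exact ⟨t, h, by omega, hp, ht⟩

open Classical in
theorem eventually_not_of_count_le {p : ℕ → Prop} {B : ℕ} (h : ∀ s, Nat.count p s ≤ B) :
    ∀ᶠ t in atTop, ¬ p t := by
  have hfin : {t | p t}.Finite := by
    by_contra hinf
    have := h (Nat.nth p (B + 1))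
    rw [Nat.count_nth_of_infinite hinf] at this
    omega
  obtain ⟨b, hb⟩ := hfin.bddAbove
  filter_upwards [eventually_gt_atTop b] with t ht hp
  exact absurd (hb hp) (by omega)

open Classical in
theorem count_le_count_of_imp {p q : ℕ → Prop} {n : ℕ} (h : ∀ k < n, p k → q k) :
    Nat.count p n ≤ Nat.count q n := by
  simp only [Nat.count_eq_card_filter_range]
  refine Finset.card_le_card fun k hk => ?_
  rw [Finset.mem_filter] at hk ⊢
  exact ⟨hk.1, h k (Finset.mem_range.1 hk.1) hk.2⟩

theorem eventually_const_of_bounded {g : ℕ → ℕ} {B T : ℕ} (hB : ∀ t, g t ≤ B)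
    (hmono : ∀ t ≥ T, g t ≤ g (t + 1)) : ∃ v, ∀ᶠ t in atTop, g t = v := by
  have hm : Monotone fun t => g (T + t) := monotone_nat_of_le_succ fun t => hmono _ (by omega)
  obtain ⟨m, hm'⟩ : ∃ m, ∀ t, g (T + t) ≤ g (T + m) := by
    have hb : BddAbove (Set.range fun t => g (T + t)) := ⟨B, by rintro _ ⟨t, rfl⟩; exact hB _⟩
    obtain ⟨m, h⟩ := Nat.sSup_mem (Set.range_nonempty _) hb
    exact ⟨m, fun t => (le_csSup hb ⟨t, rfl⟩).trans h.ge⟩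
  refine ⟨g (T + m), ?_⟩
  filter_upwards [eventually_ge_atTop (T + m)] with t ht
  obtain ⟨d, rfl⟩ := Nat.exists_eq_add_of_le ht
  have := hm' (m + d)
  have h2 := hm (show m ≤ m + d by omega)
  simp only at h2
  rw [add_assoc]
  omega

/-! ### Level systems: bounds on resets and selections, limits, and the weak array -/

section
variable {K : ℕ → ℕ → ℕ → Prop} {D : ℕ → ℕ → Prop}

theorem FoundAbove.anti {θ θ' t n : ℕ} (h : θ ≤ θ') (hf : FoundAbove K θ' t n) :
    FoundAbove K θ t n := by
  obtain ⟨x, hx, h1, h2⟩ := hf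
  exact ⟨x, hx, h.trans h1, h2⟩

theorem threshold_succ_of_reset {t k : ℕ} (h : Reset K D t k) : threshold K D (t + 1) k = t + 1 := by
  rw [threshold]; exact if_pos h

theorem threshold_succ_of_not_reset {t k : ℕ} (h : ¬ Reset K D t k) :
    threshold K D (t + 1) k = threshold K D t k := by
  rw [threshold]; exact if_neg h

theorem threshold_le (t k : ℕ) : threshold K D t k ≤ t := by
  induction t with
  | zero => simp [threshold]
  | succ t ih =>
    by_cases h : Reset K D t k
    · rw [threshold_succ_of_reset h]
    · rw [threshold_succ_of_not_reset h]; omega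

theorem threshold_mono_stage (k : ℕ) : Monotone fun t => threshold K D t k := by
  refine monotone_nat_of_le_succ fun t => ?_
  by_cases h : Reset K D t k
  · have := threshold_le (K := K) (D := D) t k
    rw [threshold_succ_of_reset h]; omega
  · rw [threshold_succ_of_not_reset h]

open Classical in
theorem exceeded_le (t n : ℕ) : exceeded K D t n ≤ n + 1 := Nat.count_le _

theorem tamed_le_exceeded (t n : ℕ) : tamed K D t n ≤ exceeded K D t n := by
  cases n with
  | zero => exact le_rfl
  | succ n => exact min_le_left _ _

namespace LevelSystem

variable (h : LevelSystem K D)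
include h

theorem foundAbove_mono {θ t m n : ℕ} (hmn : m ≤ n) (hf : FoundAbove K θ t m) :
    FoundAbove K θ t n := by
  obtain ⟨x, hx, h1, h2⟩ := hf
  exact ⟨x, hx, h1, h.mono hmn h2⟩

theorem foundAbove_succ {θ t n : ℕ} (hD : ¬ D n t) (hf : FoundAbove K θ t n) :
    FoundAbove K θ (t + 1) n := by
  obtain ⟨x, hx, h1, h2⟩ := hf
  exact ⟨x, by omega, h1, h.persist hD h2⟩

theorem reset_mono {t j k : ℕ} (hjk : j ≤ k) (hr : Reset K D t j) : Reset K D t k := by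
  rcases hr with hd | ⟨i, hi, hx⟩
  · exact Or.inl (h.die_mono hjk hd)
  · exact Or.inr ⟨i, by omega, hx⟩

theorem not_die_of_not_reset {t j k : ℕ} (hjk : j ≤ k) (hr : ¬ Reset K D t k) : ¬ D j t :=
  fun hd => hr (Or.inl (h.die_mono hjk hd))

theorem threshold_mono (t : ℕ) : Monotone (threshold K D t) := by
  induction t with
  | zero => intro a b _; simp [threshold]
  | succ t ih =>
    intro a b hab
    by_cases hb : Reset K D t b
    · rw [threshold_succ_of_reset hb]; exact threshold_le _ _
    · rw [threshold_succ_of_not_reset hb,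
        threshold_succ_of_not_reset fun ha => hb (h.reset_mono hab ha)]
      exact ih hab

theorem threshold_succ_of_le {t j k : ℕ} (hjk : j ≤ k) (hr : ¬ Reset K D t k) :
    threshold K D (t + 1) j = threshold K D t j :=
  threshold_succ_of_not_reset fun ha => hr (h.reset_mono hjk ha)

theorem found_succ {t k : ℕ} (hr : ¬ Reset K D t k) (hf : Found K D t k) :
    Found K D (t + 1) k := by
  rw [Found, threshold_succ_of_not_reset hr]
  exact h.foundAbove_succ (h.not_die_of_not_reset le_rfl hr) hf

-- A found level stays found until it is reset, so a reset separates any two discoveries; the last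
-- summand pays for the latest discovery.
open Classical in
theorem count_newly_le (j s : ℕ) :
    Nat.count (fun t => ¬ Found K D t j ∧ FoundAbove K (threshold K D t j) (t + 1) j) s ≤
      Nat.count (fun t => Reset K D t j) s + if Found K D s j then 1 else 0 := by
  induction s with
  | zero => simp
  | succ s ih =>
    rw [Nat.count_succ, Nat.count_succ]
    by_cases hr : Reset K D s j
    · rw [if_pos hr]
      split_ifs at ih ⊢ <;> first | omega | tauto
    · have h1 : Found K D s j → Found K D (s + 1) j := h.found_succ hr
      have h2 : FoundAbove K (threshold K D s j) (s + 1) j → Found K D (s + 1) j := by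
        intro h'; rwa [Found, threshold_succ_of_not_reset hr]
      rw [if_neg hr]
      split_ifs at ih ⊢ <;> first | omega | tauto

omit h in
theorem sum_pow_le (k : ℕ) : ∑ j ∈ Finset.range k, (5 * 4 ^ j + 1) ≤ 3 * 4 ^ k := by
  induction k with
  | zero => simp
  | succ k ih =>
    rw [Finset.sum_range_succ, pow_succ]
    have := Nat.one_le_pow k 4 (by norm_num)
    omega

-- Index k is reset by at most 2 · 4^k refutations and by discoveries at levels j < k, each of which
-- has at most one discovery more than resets. The induction closes because 2 · 4^k plus the sum of
-- 5 · 4^j + 1 over j < k is at most 5 · 4^k.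
open Classical in
theorem count_reset_le (k s : ℕ) : Nat.count (fun t => Reset K D t k) s ≤ 5 * 4 ^ k := by
  induction k using Nat.strong_induction_on with
  | _ k ih =>
    have hsub : (Finset.range s).filter (fun t => Reset K D t k) ⊆
        (Finset.range s).filter (D k) ∪ (Finset.range k).biUnion fun j =>
          (Finset.range s).filter
            (fun t => ¬ Found K D t j ∧ FoundAbove K (threshold K D t j) (t + 1) j) := by
      intro t ht
      rw [Finset.mem_filter] at ht
      rcases ht.2 with hd | ⟨j, hj, h1, h2⟩
      · exact Finset.mem_union_left _ (Finset.mem_filter.2 ⟨ht.1, hd⟩)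
      · exact Finset.mem_union_right _ (Finset.mem_biUnion.2
          ⟨j, Finset.mem_range.2 hj, Finset.mem_filter.2 ⟨ht.1, h1, h2⟩⟩)
    have h1 := (Finset.card_le_card hsub).trans (Finset.card_union_le _ _)
    have h2 := h.die_count k s
    rw [← Nat.count_eq_card_filter_range, ← Nat.count_eq_card_filter_range] at h1
    have h3 := Finset.card_biUnion_le (s := Finset.range k) (t := fun j =>
      (Finset.range s).filter
        (fun t => ¬ Found K D t j ∧ FoundAbove K (threshold K D t j) (t + 1) j))
    have h4 : ∑ j ∈ Finset.range k, ((Finset.range s).filter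
        (fun t => ¬ Found K D t j ∧ FoundAbove K (threshold K D t j) (t + 1) j)).card ≤
        ∑ j ∈ Finset.range k, (5 * 4 ^ j + 1) := by
      refine Finset.sum_le_sum fun j hj => ?_
      rw [← Nat.count_eq_card_filter_range]
      refine (h.count_newly_le j s).trans (add_le_add (ih j (Finset.mem_range.1 hj)) ?_)
      split_ifs <;> omega
    have h5 := sum_pow_le k
    omega

theorem exceeded_mono (t : ℕ) : Monotone (exceeded K D t) := by
  classical
  refine monotone_nat_of_le_succ fun n => ?_
  unfold exceeded
  rw [Nat.count_succ _ (n + 1)]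
  refine (count_le_count_of_imp fun k _ hk => ?_).trans (Nat.le_add_right _ _)
  exact h.foundAbove_mono (Nat.le_succ n) hk

theorem tamed_le_tamed_succ (t n : ℕ) : tamed K D t n ≤ tamed K D t (n + 1) := by
  rw [tamed]
  exact le_min ((tamed_le_exceeded t n).trans (h.exceeded_mono t (Nat.le_succ n))) (by omega)

/-- Thresholds increase with the index, so the exceeded ones form an initial segment. -/
theorem lt_exceeded_iff {t n k : ℕ} (hk : k ≤ n) :
    k < exceeded K D t n ↔ FoundAbove K (threshold K D t k) t n := by
  classical
  constructor
  · intro hlt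
    by_contra hnf
    have hall : ∀ i, k ≤ i → ¬ FoundAbove K (threshold K D t i) t n :=
      fun i hi hf => hnf (hf.anti (h.threshold_mono t hi))
    have : exceeded K D t n ≤ k := by
      unfold exceeded
      obtain ⟨d, hd⟩ := Nat.exists_eq_add_of_le (show k ≤ n + 1 by omega)
      rw [hd, Nat.count_add]
      have h0 : Nat.count (fun i => FoundAbove K (threshold K D t (k + i)) t n) d = 0 :=
        by
          rw [Nat.count_iff_forall_not]
          intro m _; exact hall _ (by omega)
      rw [h0]
      exact Nat.count_le _
    omega
  · intro hf
    unfold exceeded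
    have h1 : Nat.count (fun i => FoundAbove K (threshold K D t i) t n) (k + 1) = k + 1 := by
      rw [Nat.count_iff_forall]
      intro i hi
      exact hf.anti (h.threshold_mono t (by omega))
    have h2 := Nat.count_monotone (fun i => FoundAbove K (threshold K D t i) t n)
      (show k + 1 ≤ n + 1 by omega)
    omega

theorem exceeded_le_succ {t n : ℕ} (hr : ¬ Reset K D t n) :
    exceeded K D t n ≤ exceeded K D (t + 1) n := by
  classical
  unfold exceeded
  refine count_le_count_of_imp fun k hk hf => ?_
  rw [h.threshold_succ_of_le (by omega : k ≤ n) hr]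
  exact h.foundAbove_succ (h.not_die_of_not_reset le_rfl hr) hf

theorem tamed_le_stage_succ {t n : ℕ} (hr : ¬ Reset K D t n) :
    tamed K D t n ≤ tamed K D (t + 1) n := by
  induction n with
  | zero => exact h.exceeded_le_succ hr
  | succ n ih =>
    have := ih fun h' => hr (h.reset_mono (Nat.le_succ n) h')
    rw [tamed, tamed]
    exact min_le_min (h.exceeded_le_succ hr) (by omega)

-- The cap on growth makes drops cheap: each reset index accounts for a loss of at most two. For
-- `exceeded` a single reset could cost up to n + 1, and the resulting factor n in the number of
-- selections would be too much for programs of length 2n + O(1).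
open Classical in
theorem tamed_le_add_count (t n : ℕ) :
    tamed K D t n ≤ tamed K D (t + 1) n + 2 * Nat.count (Reset K D t) (n + 1) := by
  induction n with
  | zero =>
    by_cases hr : Reset K D t 0
    · have := (tamed_le_exceeded (K := K) (D := D) t 0).trans (exceeded_le t 0)
      rw [Nat.count_succ, if_pos hr]; omega
    · have := h.tamed_le_stage_succ hr; omega
  | succ n ih =>
    by_cases hr : Reset K D t (n + 1)
    · have h1 : tamed K D t (n + 1) ≤ tamed K D t n + 2 := min_le_right _ _
      have h2 := h.tamed_le_tamed_succ (t + 1) n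
      rw [Nat.count_succ _ (n + 1), if_pos hr]; omega
    · have := h.tamed_le_stage_succ hr; omega

omit h in
open Classical in
theorem selectCond_spec {n t : ℕ} {L : List ℕ} (hc : SelectCond K D n t L) :
    threshold K D t (tamed K D t n) ≤ Nat.findGreatest (fun x => K (n + 1) x t) t ∧
      K (n + 1) (Nat.findGreatest (fun x => K (n + 1) x t) t) t := by
  obtain ⟨x, hx, h1, h2⟩ := hc.2.2.1
  exact ⟨h1.trans (Nat.le_findGreatest hx.le h2),
    Nat.findGreatest_spec (P := fun x => K (n + 1) x t) hx.le h2⟩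

/-- Some selected element is still in its level and above the current threshold. -/
def Occupied (K : ℕ → ℕ → ℕ → Prop) (D : ℕ → ℕ → Prop) (n t : ℕ) : Prop :=
  ∃ x ∈ selected K D n t, threshold K D t (tamed K D t n) ≤ x ∧ K (n + 1) x t

omit h in
theorem selected_succ_of_not {n t : ℕ} (hc : ¬ SelectCond K D n t (selected K D n t)) :
    selected K D n (t + 1) = selected K D n t := by
  rw [selected]; exact if_neg hc

omit h in
open Classical in
theorem selected_succ_of {n t : ℕ} (hc : SelectCond K D n t (selected K D n t)) :
    selected K D n (t + 1) =
      selected K D n t ++ [Nat.findGreatest (fun x => K (n + 1) x t) t] := by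
  rw [selected]; exact if_pos hc

omit h in
theorem selected_prefix {n s t : ℕ} (hst : s ≤ t) : selected K D n s <+: selected K D n t := by
  induction t, hst using Nat.le_induction with
  | base => exact List.prefix_rfl
  | succ t _ ih =>
    by_cases hc : SelectCond K D n t (selected K D n t)
    · rw [selected_succ_of hc]; exact ih.trans (List.prefix_append _ _)
    · rwa [selected_succ_of_not hc]

-- A potential argument. A selection requires that the level be unoccupied. Without a reset of index
-- n + 1, `tamed` does not fall, a selection leads to occupation or to a rise of `tamed`, and
-- occupation is lost only through such a rise. With a reset, the indices up to n pay for the drop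
-- of `tamed`, and index n + 1 pays for one selection and one loss of occupation.
open Classical in
theorem length_selected_le_aux (n s : ℕ) :
    (selected K D n s).length ≤ tamed K D s n + (if Occupied K D n s then 1 else 0) +
      ∑ t ∈ Finset.range s, 2 * Nat.count (Reset K D t) (n + 2) := by
  induction s with
  | zero => simp [selected]
  | succ s ih =>
    rw [Finset.sum_range_succ]
    by_cases hr : Reset K D s (n + 1)
    · have h1 : (selected K D n (s + 1)).length ≤ (selected K D n s).length + 1 := by
        rw [selected]; split_ifs <;> simp
      have h2 := h.tamed_le_add_count s n
      rw [Nat.count_succ _ (n + 1), if_pos hr]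
      split_ifs at ih ⊢ <;> omega
    · have h1 := h.tamed_le_stage_succ fun h' => hr (h.reset_mono (Nat.le_succ n) h')
      have hD := h.not_die_of_not_reset le_rfl hr
      have hocc : ∀ x ∈ selected K D n (s + 1), threshold K D s (tamed K D s n) ≤ x →
          K (n + 1) x s → tamed K D s n = tamed K D (s + 1) n → Occupied K D n (s + 1) := by
        intro x hx h2 h3 h4
        refine ⟨x, hx, ?_, h.persist hD h3⟩
        rw [← h4, h.threshold_succ_of_le _ hr]
        · exact h2
        · exact (tamed_le_exceeded s n).trans (exceeded_le s n)
      by_cases hc : SelectCond K D n s (selected K D n s)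
      · have h2 := hocc _ (by rw [selected_succ_of hc]; simp) (selectCond_spec hc).1
          (selectCond_spec hc).2
        have h3 : ¬ Occupied K D n s := by
          rintro ⟨x, hx, hx'⟩
          exact hc.2.2.2 x hx hx'
        rw [if_neg h3] at ih
        have h4 : (selected K D n (s + 1)).length = (selected K D n s).length + 1 := by
          rw [selected_succ_of hc]; simp
        by_cases h5 : tamed K D s n = tamed K D (s + 1) n
        · rw [if_pos (h2 h5)]; omega
        · omega
      · rw [selected_succ_of_not hc]
        by_cases h5 : tamed K D s n = tamed K D (s + 1) n
        · by_cases ho : Occupied K D n s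
          · have ho' : Occupied K D n (s + 1) := by
              obtain ⟨x, hx, h6, h7⟩ := ho
              exact hocc x (by rwa [selected_succ_of_not hc]) h6 h7 h5
            rw [if_pos ho] at ih; rw [if_pos ho']; omega
          · rw [if_neg ho] at ih; omega
        · split_ifs at ih ⊢ <;> omega

theorem length_selected_le (n s : ℕ) : (selected K D n s).length ≤ 4 ^ (n + 4) := by
  classical
  have h1 := h.length_selected_le_aux n s
  have h2 := (tamed_le_exceeded (K := K) (D := D) s n).trans (exceeded_le s n)
  have h3 : ∑ t ∈ Finset.range s, 2 * Nat.count (Reset K D t) (n + 2) ≤ 6 * 4 ^ (n + 2) := by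
    rw [← Finset.mul_sum]
    have : ∑ t ∈ Finset.range s, Nat.count (Reset K D t) (n + 2) ≤ 3 * 4 ^ (n + 2) := by
      refine le_trans ?_ (sum_pow_le (n + 2))
      simp only [Nat.count_eq_card_filter_range, Finset.card_filter]
      -- Summing over indices instead of stages gives a geometric sum.
      rw [Finset.sum_comm]
      refine Finset.sum_le_sum fun k _ => ?_
      rw [← Finset.card_filter, ← Nat.count_eq_card_filter_range]
      exact (h.count_reset_le k s).trans (Nat.le_succ _)
    omega
  -- The total is at most n + 2 + 96 · 4^n, which is below 256 · 4^n.
  have h4 : n < 4 ^ n := Nat.lt_pow_self (by norm_num)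
  rw [pow_add] at h3 ⊢
  split_ifs at h1 <;> omega

/-- `x` is in level `n` from some stage on. -/
def Lasting (K : ℕ → ℕ → ℕ → Prop) (n x : ℕ) : Prop := ∀ᶠ t in atTop, K n x t

theorem lasting_mono {m n x : ℕ} (hmn : m ≤ n) (hx : Lasting K m x) : Lasting K n x :=
  hx.mono fun _ => h.mono hmn

theorem eventually_not_reset (n : ℕ) : ∀ᶠ t in atTop, ¬ Reset K D t n := by
  classical
  exact eventually_not_of_count_le (h.count_reset_le n)

theorem exists_forall_not_reset (n : ℕ) : ∃ T, ∀ t ≥ T, ¬ Reset K D t n :=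
  eventually_atTop.1 (h.eventually_not_reset n)

theorem lasting_of_forall_not_reset {n x T : ℕ} (hT : ∀ t ≥ T, ¬ Reset K D t n)
    (hx : K n x T) : Lasting K n x := by
  refine eventually_atTop.2 ⟨T, fun t ht => ?_⟩
  induction t, ht using Nat.le_induction with
  | base => exact hx
  | succ t ht ih => exact h.persist (h.not_die_of_not_reset le_rfl (hT t ht)) ih

theorem exists_limit_threshold (k : ℕ) : ∃ θ, ∀ᶠ t in atTop, threshold K D t k = θ := by
  obtain ⟨T, hT⟩ := h.exists_forall_not_reset k
  refine ⟨threshold K D T k, eventually_atTop.2 ⟨T, fun t ht => ?_⟩⟩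
  induction t, ht using Nat.le_induction with
  | base => rfl
  | succ t ht ih => rw [threshold_succ_of_not_reset (hT t ht), ih]

theorem exists_limit_exceeded (n : ℕ) : ∃ v, ∀ᶠ t in atTop, exceeded K D t n = v := by
  obtain ⟨T, hT⟩ := h.exists_forall_not_reset n
  exact eventually_const_of_bounded (fun t => exceeded_le t n)
    fun t ht => h.exceeded_le_succ (hT t ht)

theorem exists_limit_tamed (n : ℕ) : ∃ v, ∀ᶠ t in atTop, tamed K D t n = v := by
  obtain ⟨T, hT⟩ := h.exists_forall_not_reset n
  exact eventually_const_of_bounded (fun t => (tamed_le_exceeded t n).trans (exceeded_le t n))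
    fun t ht => h.tamed_le_stage_succ (hT t ht)

theorem lt_limit_exceeded_iff {n k v θ : ℕ} (hv : ∀ᶠ t in atTop, exceeded K D t n = v)
    (hθ : ∀ᶠ t in atTop, threshold K D t k = θ) (hk : k ≤ n) :
    k < v ↔ ∃ x ≥ θ, Lasting K n x := by
  obtain ⟨T, hT⟩ := eventually_atTop.1 (hv.and (hθ.and (h.eventually_not_reset n)))
  constructor
  · intro hlt
    rw [← (hT T le_rfl).1, h.lt_exceeded_iff hk, (hT T le_rfl).2.1] at hlt
    obtain ⟨x, _, h1, h2⟩ := hlt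
    exact ⟨x, h1, h.lasting_of_forall_not_reset (fun t ht => (hT t ht).2.2) h2⟩
  · rintro ⟨x, hx, hl⟩
    obtain ⟨t, ht, hT'⟩ := (hl.and (eventually_ge_atTop T)).exists
    rw [← (hT t hT').1, h.lt_exceeded_iff hk, (hT t hT').2.1]
    exact ⟨x, h.lt ht, hx, ht⟩

/-- Beyond this level the passage from level n + 1 down to level n holds for the exceptional
elements as well. -/
theorem exists_level_capturing {E : Set ℕ} (hE : E.Finite) :
    ∃ N, ∀ x ∈ E, ∀ m, Lasting K m x → Lasting K N x := by
  have hx : ∀ x, ∃ N, ∀ m, Lasting K m x → Lasting K N x := by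
    intro x
    by_cases hm : ∃ m, Lasting K m x
    · exact ⟨hm.choose, fun _ _ => hm.choose_spec⟩
    · exact ⟨0, fun m hl => absurd ⟨m, hl⟩ hm⟩
  choose N hN using hx
  obtain ⟨B, hB⟩ := (hE.image N).bddAbove
  exact ⟨B, fun x hxE m hl => h.lasting_mono (hB ⟨x, hxE, rfl⟩) (hN x m hl)⟩

/-- If selected elements (with finitely many exceptions) never first appear in the level from which
they are selected, then almost all levels eventually exceed their own threshold. -/
theorem exists_forall_eventually_found {E : Set ℕ} (hE : E.Finite)
    (hsel : ∀ n t, ∀ x ∈ selected K D n t, x ∉ E → Lasting K (n + 1) x → Lasting K n x)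
    (hinf : ∀ B, ∃ n, ∃ x ≥ B, Lasting K n x) :
    ∃ k₀, ∀ k ≥ k₀, ∀ᶠ t in atTop, Found K D t k := by
  choose F hF using h.exists_limit_exceeded
  choose e he using h.exists_limit_tamed
  choose θ hθ using h.exists_limit_threshold
  obtain ⟨N, hN⟩ := h.exists_level_capturing hE
  have hFle : ∀ n, F n ≤ n + 1 := fun n => by
    obtain ⟨t, ht⟩ := (hF n).exists
    exact ht ▸ exceeded_le t n
  have heF : ∀ n, e n ≤ F n := fun n => by
    obtain ⟨t, ht, ht'⟩ := ((hF n).and (he n)).exists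
    exact ht ▸ ht' ▸ tamed_le_exceeded t n
  have he_succ : ∀ n, e (n + 1) = min (F (n + 1)) (e n + 2) := fun n => by
    obtain ⟨t, h1, h2, h3⟩ := ((hF (n + 1)).and ((he n).and (he (n + 1)))).exists
    rw [← h1, ← h2, ← h3, tamed]
  have he_mono : Monotone e := monotone_nat_of_le_succ fun n => by
    obtain ⟨t, h2, h3⟩ := ((he n).and (he (n + 1))).exists
    rw [← h2, ← h3]; exact h.tamed_le_tamed_succ t n
  have hFk : ∀ {n k}, k ≤ n → (k < F n ↔ ∃ x ≥ θ k, Lasting K n x) :=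
    fun {n k} hk => h.lt_limit_exceeded_iff (hF n) (hθ k) hk
  -- At a late stage either the greatest element of the level is selected, or an earlier selection
  -- is still in the level above the threshold. Either one lasts, as index n + 1 is no longer reset.
  have hselect : ∀ n, F n = e n → e n ≤ n → (∃ x ≥ θ (e n), Lasting K (n + 1) x) →
      ∃ t, ∃ y ∈ selected K D n t, θ (e n) ≤ y ∧ Lasting K (n + 1) y := by
    rintro n h1 h2 ⟨x, hx, hl⟩
    obtain ⟨T, hT⟩ := eventually_atTop.1 ((hF n).and ((he n).and ((hθ (e n)).and
      ((h.eventually_not_reset (n + 1)).and hl))))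
    have hlast : ∀ y, K (n + 1) y T → Lasting K (n + 1) y := fun y =>
      h.lasting_of_forall_not_reset fun t ht => (hT t ht).2.2.2.1
    obtain ⟨t1, t2, t3, -, t5⟩ := hT T le_rfl
    by_cases hc : SelectCond K D n T (selected K D n T)
    · classical
      refine ⟨T + 1, _, by rw [selected_succ_of hc]; simp, ?_, hlast _ (selectCond_spec hc).2⟩
      have := (selectCond_spec hc).1
      rwa [t2, t3] at this
    · have : ¬ ∀ y ∈ selected K D n T, ¬ (threshold K D T (tamed K D T n) ≤ y ∧ K (n + 1) y T) :=
        fun h' => hc ⟨by rw [t1, t2, h1], by rwa [t2],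
          ⟨x, h.lt t5, by rwa [t2, t3], t5⟩, h'⟩
      push Not at this
      obtain ⟨y, hy, h3, h4⟩ := this
      rw [t2, t3] at h3
      exact ⟨T, y, hy, h3, hlast y h4⟩
  -- Otherwise no element of level n lasts above θ (e n), though some higher level has one. Where
  -- such elements first occur, in passing from m to m + 1, both F m and e m still equal e n, so one
  -- of them is selected; it then lasts in level m already.
  have claim : ∀ n ≥ N, F n = n + 1 ∨ e n < F n := by
    intro n hn
    by_contra hcon
    push Not at hcon
    obtain ⟨h1, h2⟩ := hcon
    have hFe : F n = e n := le_antisymm h2 (heF n)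
    have hle : e n ≤ n := by have := hFle n; omega
    have hno : ¬ ∃ x ≥ θ (e n), Lasting K n x := fun h' => by
      have := (hFk hle).2 h'; omega
    obtain ⟨m₀, x₀, hx₀, hl₀⟩ := hinf (θ (e n))
    have hm₀ : n ≤ m₀ := by
      by_contra hlt
      exact hno ⟨x₀, hx₀, h.lasting_mono (by omega) hl₀⟩
    obtain ⟨m, hnm, -, hm1, hm2⟩ := exists_step_of_le
      (p := fun m => ∃ x ≥ θ (e n), Lasting K m x) hm₀ hno ⟨x₀, hx₀, hl₀⟩
    have hFm : F m ≤ e n := by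
      by_contra hlt
      exact hm1 ((hFk (by omega)).1 (not_le.1 hlt))
    have hem : e m = e n := le_antisymm ((heF m).trans hFm) (he_mono hnm)
    have hFm' : F m = e m := le_antisymm (hem ▸ hFm) (heF m)
    obtain ⟨t, y, hy, hθy, hly⟩ := hselect m hFm' (by omega) (by rwa [hem])
    rw [hem] at hθy
    refine hm1 ⟨y, hθy, ?_⟩
    by_cases hyE : y ∈ E
    · exact h.lasting_mono (hn.trans hnm) (hN y hyE _ hly)
    · exact hsel m t y hy hyE hly
  -- By `claim`, either the cap e n + 2 decides the minimum, or F (n + 1) has its largest possible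
  -- value n + 2.
  have hgrow : ∀ n ≥ N, min (n + 2) (e n + 2) ≤ e (n + 1) := by
    intro n hn
    have h1 := he_succ n
    have h2 : F (n + 1) = n + 2 ∨ e (n + 1) < F (n + 1) := claim (n + 1) (by omega)
    rcases h2 with h2 | h2 <;> omega
  have hgrow' : ∀ j, min (N + j + 1) (2 * j) ≤ e (N + j) := by
    intro j
    induction j with
    | zero => simp
    | succ j ih =>
      have := hgrow (N + j) (by omega)
      rw [← add_assoc]
      omega
  -- For k ≥ 2N + 1 also 2(k - N) ≥ k + 1, so e k exceeds k.
  refine ⟨2 * N + 1, fun k hk => ?_⟩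
  have h1 := hgrow' (k - N)
  rw [Nat.add_sub_cancel' (by omega)] at h1
  have h2 : k < F k := by have := heF k; omega
  filter_upwards [hF k] with t ht
  rw [← ht, h.lt_exceeded_iff le_rfl] at h2
  exact h2

/-- `x` witnesses at stage `t` that level `k` becomes found while all levels from `k₀` up to `k`
are found already. -/
def FirstFound (K : ℕ → ℕ → ℕ → Prop) (D : ℕ → ℕ → Prop) (k₀ k t x : ℕ) : Prop :=
  ¬ Found K D t k ∧ (∀ j < k, k₀ ≤ j → Found K D t j) ∧ threshold K D t k ≤ x ∧ K k x (t + 1)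

theorem exists_reset_of_found {j s t : ℕ} (hst : s ≤ t) (hs : Found K D s j)
    (ht : ¬ Found K D t j) : ∃ u, s ≤ u ∧ u < t ∧ Reset K D u j := by
  obtain ⟨u, h1, h2, h3, h4⟩ := exists_step_of_le (p := fun t => ¬ Found K D t j) hst
    (not_not.2 hs) ht
  refine ⟨u, h1, h2, ?_⟩
  by_contra hr
  exact h4 (h.found_succ hr (not_not.1 h3))

omit h in
theorem reset_of_newly {j k t : ℕ} (hjk : j < k) (h1 : ¬ Found K D t j)
    (h2 : FoundAbove K (threshold K D t j) (t + 1) j) : Reset K D t k :=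
  Or.inr ⟨j, hjk, h1, h2⟩

/-- The earlier event leads to a reset that lifts the other threshold above x. A discovery at level
j resets k at once. Conversely, level j was found when x was recorded for k, so it must be reset
before it can be discovered again. -/
theorem not_firstFound_of_lt {k₀ j k x t t' : ℕ} (hj : k₀ ≤ j) (hjk : j < k)
    (h1 : FirstFound K D k₀ j t x) (h2 : FirstFound K D k₀ k t' x) : False := by
  obtain ⟨a1, -, a3, a4⟩ := h1
  obtain ⟨b1, b2, b3, b4⟩ := h2
  have hx1 := h.lt a4
  have hx2 := h.lt b4
  rcases lt_trichotomy t t' with hlt | rfl | hlt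
  · have hr : Reset K D t k := reset_of_newly hjk a1 ⟨x, hx1, a3, a4⟩
    have h3 := threshold_mono_stage (K := K) (D := D) k (show t + 1 ≤ t' by omega)
    simp only [threshold_succ_of_reset hr] at h3
    omega
  · exact a1 (b2 j hjk hj)
  · obtain ⟨u, hu1, hu2, hr⟩ := h.exists_reset_of_found hlt.le (b2 j hjk hj) a1
    have h3 := threshold_mono_stage (K := K) (D := D) j (show u + 1 ≤ t by omega)
    simp only [threshold_succ_of_reset hr] at h3
    omega

theorem firstFound_finite {k₀ k : ℕ} (hk : ∀ᶠ t in atTop, Found K D t k) :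
    {x | ∃ t, FirstFound K D k₀ k t x}.Finite := by
  obtain ⟨T, hT⟩ := eventually_atTop.1 hk
  refine (Set.finite_Iio (T + 1)).subset ?_
  rintro x ⟨t, h1, -, -, h4⟩
  have ht : t < T := by
    by_contra hlt
    exact h1 (hT t (not_lt.1 hlt))
  have := h.lt h4
  rw [Set.mem_Iio]; omega

/-- Start just after the last reset of k, or at stage 0, when nothing lies above the threshold. From
then on the levels from k₀ to k - 1 are all found, since a later discovery there would reset k
again. So the next discovery at level k is recorded, and it lasts. -/
theorem exists_firstFound_lasting {k₀ k : ℕ} (hk : k₀ ≤ k)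
    (hf : ∀ j ≥ k₀, ∀ᶠ t in atTop, Found K D t j) :
    ∃ x t, FirstFound K D k₀ k t x ∧ Lasting K k x := by
  classical
  have hex := h.exists_forall_not_reset k
  set T := Nat.find hex with hTdef
  have hT : ∀ t ≥ T, ¬ Reset K D t k := Nat.find_spec hex
  have hnf : ¬ Found K D T k := by
    rintro ⟨x, hx, h1, -⟩
    rcases Nat.eq_zero_or_pos T with h0 | h0
    · omega
    · obtain ⟨S, hS⟩ : ∃ S, T = S + 1 := ⟨T - 1, by omega⟩
      have hmin := Nat.find_min hex (m := S) (by omega)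
      push Not at hmin
      obtain ⟨t, ht, hr⟩ := hmin
      have : t = S := by
        by_contra hne
        exact hT t (by omega) hr
      subst this
      rw [hS, threshold_succ_of_reset hr] at h1
      omega
  have hstep : ∀ j ≥ k₀, ∀ s, ¬ Found K D s j → ∃ u ≥ s, ¬ Found K D u j ∧ Found K D (u + 1) j := by
    intro j hj s hs
    obtain ⟨t, ht, hst⟩ := ((hf j hj).and (eventually_ge_atTop s)).exists
    obtain ⟨u, h1, -, h3⟩ := exists_step_of_le (p := fun t => Found K D t j) hst hs ht
    exact ⟨u, h1, h3⟩
  have hall : ∀ t ≥ T, ∀ j < k, k₀ ≤ j → Found K D t j := by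
    intro t ht j hjk hj
    by_contra hn
    obtain ⟨u, hu, h1, h2⟩ := hstep j hj t hn
    rw [Found, h.threshold_succ_of_le hjk.le (hT u (by omega))] at h2
    exact hT u (by omega) (reset_of_newly hjk h1 h2)
  obtain ⟨u, hu, h1, h2⟩ := hstep k hk T hnf
  rw [Found, threshold_succ_of_not_reset (hT u hu)] at h2
  obtain ⟨x, -, h3, h4⟩ := h2
  exact ⟨x, u, ⟨h1, hall u hu, h3, h4⟩,
    h.lasting_of_forall_not_reset (fun t ht => hT t (by omega)) h4⟩

end LevelSystem
end

/-! ### The construction is primitive recursive -/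

section
variable {K : ℕ → ℕ → ℕ → Prop} {D : ℕ → ℕ → Prop} {α : Type*} [Primcodable α]

theorem primrecPred_foundAbove (hK : PrimrecPred fun q : ℕ × ℕ × ℕ => K q.1 q.2.1 q.2.2)
    {θ t n : α → ℕ} (hθ : Primrec θ) (ht : Primrec t) (hn : Primrec n) :
    PrimrecPred fun a => FoundAbove K (θ a) (t a) (n a) := by
  refine PrimrecPred.exists_lt_of ht (.and ?_ ?_)
  · exact Primrec.nat_le.comp (hθ.comp .fst) .snd
  · exact hK.comp ((hn.comp .fst).pair (Primrec.snd.pair (ht.comp .fst)))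

/-- Resetting index k consults only thresholds of smaller index, so the recursion can run on the
finite list of thresholds up to a fixed index. -/
theorem primrec_threshold (hK : PrimrecPred fun q : ℕ × ℕ × ℕ => K q.1 q.2.1 q.2.2)
    (hD : PrimrecRel D) : Primrec₂ (threshold K D) := by
  classical
  let step : ℕ → ℕ × List ℕ → List ℕ := fun B q => (List.range (B + 1)).map fun k =>
    if ResetStep K D q.1 k (fun j => q.2.getD j 0) then q.1 + 1 else q.2.getD k 0
  have hstep : Primrec₂ step := by
    refine Primrec.list_map (Primrec.list_range.comp (Primrec.succ.comp .fst)) ?_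
    have ht : Primrec fun r : (ℕ × ℕ × List ℕ) × ℕ => r.1.2.1 :=
      Primrec.fst.comp (Primrec.snd.comp .fst)
    have hL : Primrec fun r : (ℕ × ℕ × List ℕ) × ℕ => r.1.2.2 :=
      Primrec.snd.comp (Primrec.snd.comp .fst)
    refine Primrec.ite (PrimrecPred.or ?_ ?_) (Primrec.succ.comp ht)
      ((Primrec.list_getD 0).comp hL .snd)
    · exact hD.comp .snd ht
    · refine PrimrecPred.exists_lt_of Primrec.snd (.and (.not ?_) ?_)
      · exact primrecPred_foundAbove hK ((Primrec.list_getD 0).comp (hL.comp .fst) .snd)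
          (ht.comp .fst) .snd
      · exact primrecPred_foundAbove hK ((Primrec.list_getD 0).comp (hL.comp .fst) .snd)
          (Primrec.succ.comp (ht.comp .fst)) .snd
  have hinit : Primrec fun B : ℕ => (List.range (B + 1)).map fun _ => 0 :=
    Primrec.list_map (Primrec.list_range.comp Primrec.succ) (Primrec.const 0).to₂
  have hrec := Primrec.nat_rec hinit hstep
  have hval : ∀ B t, (Nat.rec ((List.range (B + 1)).map fun _ => 0)
      (fun n IH => step B (n, IH)) t : List ℕ) = (List.range (B + 1)).map (threshold K D t) := by
    intro B t
    induction t with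
    | zero => rfl
    | succ t ih =>
      simp only [ih, step]
      refine List.map_congr_left fun k hk => ?_
      have hget : ∀ j, j < B + 1 →
          ((List.range (B + 1)).map (threshold K D t)).getD j 0 = threshold K D t j := by
        intro j hj
        simp [List.getD, hj]
      rw [List.mem_range] at hk
      have hiff : ResetStep K D t k
          (fun j => ((List.range (B + 1)).map (threshold K D t)).getD j 0) ↔
          ResetStep K D t k (threshold K D t) := by
        unfold ResetStep
        refine or_congr_right (exists_congr fun j => and_congr_right fun hj => ?_)
        simp only [hget j (by omega)]
      rw [threshold]
      simp only [hiff, hget k hk]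
  have : Primrec₂ fun (t k : ℕ) => ((Nat.rec ((List.range (k + 1)).map fun _ => 0)
      (fun n IH => step k (n, IH)) t : List ℕ)).getD k 0 :=
    (Primrec.list_getD 0).comp (hrec.comp Primrec.snd Primrec.fst) .snd
  refine this.of_eq fun t k => ?_
  rw [hval]
  simp [List.getD]

theorem primrec_exceeded (hK : PrimrecPred fun q : ℕ × ℕ × ℕ => K q.1 q.2.1 q.2.2)
    (hD : PrimrecRel D) : Primrec₂ (exceeded K D) := by
  classical
  refine Primrec.nat_count (Primrec.succ.comp Primrec.snd) ?_
  exact primrecPred_foundAbove hK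
    ((primrec_threshold hK hD).comp (Primrec.fst.comp .fst) .snd)
    (Primrec.fst.comp .fst) (Primrec.snd.comp .fst)

theorem primrec_tamed (hK : PrimrecPred fun q : ℕ × ℕ × ℕ => K q.1 q.2.1 q.2.2)
    (hD : PrimrecRel D) : Primrec₂ (tamed K D) := by
  have h := Primrec.nat_rec (f := fun t => exceeded K D t 0)
    (g := fun t (q : ℕ × ℕ) => min (exceeded K D t (q.1 + 1)) (q.2 + 2))
    ((primrec_exceeded hK hD).comp .id (.const 0))
    (Primrec.nat_min.comp ((primrec_exceeded hK hD).comp .fst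
      (Primrec.succ.comp (Primrec.fst.comp .snd)))
      (Primrec.nat_add.comp (Primrec.snd.comp .snd) (.const 2)))
  refine h.of_eq fun t n => ?_
  induction n with
  | zero => rfl
  | succ n ih => rw [tamed, ← ih]

theorem primrec_selected (hK : PrimrecPred fun q : ℕ × ℕ × ℕ => K q.1 q.2.1 q.2.2)
    (hD : PrimrecRel D) : Primrec₂ (selected K D) := by
  classical
  have ht : Primrec fun q : ℕ × ℕ × List ℕ => q.2.1 := Primrec.fst.comp .snd
  have hL : Primrec fun q : ℕ × ℕ × List ℕ => q.2.2 := Primrec.snd.comp .snd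
  have he := (primrec_tamed hK hD).comp ht (Primrec.fst (α := ℕ) (β := ℕ × List ℕ))
  have hθ := (primrec_threshold hK hD).comp ht he
  have hgood : PrimrecPred fun q : ℕ × ℕ × List ℕ => SelectCond K D q.1 q.2.1 q.2.2 := by
    refine .and (Primrec.eq.comp ((primrec_exceeded hK hD).comp ht .fst) he)
      (.and (Primrec.nat_le.comp he .fst) (.and (primrecPred_foundAbove hK hθ ht
        (Primrec.succ.comp .fst)) ?_))
    have h : PrimrecRel fun (L : List ℕ) (q : ℕ × ℕ × List ℕ) =>
        ∀ x ∈ L, ¬ (threshold K D q.2.1 (tamed K D q.2.1 q.1) ≤ x ∧ K (q.1 + 1) x q.2.1) := by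
      refine PrimrecRel.forall_mem_list (.not (.and ?_ ?_))
      · exact Primrec.nat_le.comp (hθ.comp .snd) .fst
      · exact hK.comp ((Primrec.succ.comp (Primrec.fst.comp .snd)).pair
          (Primrec.fst.pair (ht.comp .snd)))
    exact h.comp hL .id
  have hmax : Primrec fun q : ℕ × ℕ × List ℕ =>
      Nat.findGreatest (fun x => K (q.1 + 1) x q.2.1) q.2.1 := by
    refine Primrec.nat_findGreatest (p := fun q x => K (q.1 + 1) x q.2.1) ht ?_
    exact hK.comp ((Primrec.succ.comp (Primrec.fst.comp .fst)).pair
      (Primrec.snd.pair (ht.comp .fst)))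
  have h := Primrec.nat_rec (f := fun _ : ℕ => ([] : List ℕ))
    (g := fun n (q : ℕ × List ℕ) => if SelectCond K D n q.1 q.2 then
      q.2 ++ [Nat.findGreatest (fun x => K (n + 1) x q.1) q.1] else q.2) (.const [])
    (Primrec.ite hgood (Primrec.list_append.comp hL
      (Primrec.list_cons.comp hmax (.const []))) hL)
  refine h.of_eq fun n t => ?_
  induction t with
  | zero => rfl
  | succ t ih => simp only [ih, selected]

theorem primrecPred_firstFound (hK : PrimrecPred fun q : ℕ × ℕ × ℕ => K q.1 q.2.1 q.2.2)
    (hD : PrimrecRel D) (k₀ : ℕ) : PrimrecPred fun q : ℕ × ℕ × ℕ =>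
      LevelSystem.FirstFound K D k₀ (k₀ + q.1) q.2.1 q.2.2 := by
  have hk : Primrec fun q : ℕ × ℕ × ℕ => k₀ + q.1 := Primrec.nat_add.comp (.const k₀) .fst
  have ht : Primrec fun q : ℕ × ℕ × ℕ => q.2.1 := Primrec.fst.comp .snd
  have hx : Primrec fun q : ℕ × ℕ × ℕ => q.2.2 := Primrec.snd.comp .snd
  have hT := primrec_threshold hK hD
  have hfound : ∀ {β : Type} [Primcodable β] {t k : β → ℕ}, Primrec t → Primrec k →
      PrimrecPred fun a => Found K D (t a) (k a) := fun ht hk =>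
    primrecPred_foundAbove hK (hT.comp ht hk) ht hk
  refine .and (.not (hfound ht hk)) (.and (PrimrecPred.forall_lt_of hk ?_) (.and
    (Primrec.nat_le.comp (hT.comp ht hk) hx) (hK.comp (hk.pair (hx.pair (Primrec.succ.comp ht))))))
  exact (PrimrecPred.or (.not (Primrec.nat_le.comp (.const k₀) .snd))
    (hfound (ht.comp .fst) .snd)).of_eq fun q => imp_iff_not_or.symm

end

/-! ### Levels of programs and hard instances -/

section
open Nat.Partrec (Code)
variable {cU cA : Code} {A : Set ℕ}

/-- Program `p` is seen to reject `x` within `s` steps. -/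
def Rejects (cU : Code) (p x s : ℕ) : Prop :=
  cU.evaln s (Nat.pair p x) = some (Encodable.encode (some [false] : Option (List Bool)))

/-- Program `p` is seen to reject an element of the set enumerated by `cA` within `s` steps. -/
def Refuted (cU cA : Code) (p s : ℕ) : Prop :=
  ∃ x < s, Rejects cU p x s ∧ (cA.evaln s x).isSome

/-- `x` is rejected by some unrefuted program of length at most `2 n`. -/
def ProgramLevel (cU cA : Code) (n x s : ℕ) : Prop :=
  ∃ p < 2 * 4 ^ n, ¬ Refuted cU cA p s ∧ Rejects cU p x s

/-- Some program of length at most `2 n` is refuted right after stage `s`. -/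
def RefutationAt (cU cA : Code) (n s : ℕ) : Prop :=
  ∃ p < 2 * 4 ^ n, ¬ Refuted cU cA p s ∧ Refuted cU cA p (s + 1)

theorem Rejects.mono {p x s t : ℕ} (hst : s ≤ t) (h : Rejects cU p x s) : Rejects cU p x t :=
  Code.evaln_mono hst h

theorem Rejects.lt {p x s : ℕ} (h : Rejects cU p x s) : x < s :=
  (Nat.right_le_pair p x).trans_lt (Code.evaln_bound h)

theorem Refuted.mono {p s t : ℕ} (hst : s ≤ t) (h : Refuted cU cA p s) : Refuted cU cA p t := by
  obtain ⟨x, hx, h1, h2⟩ := h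
  exact ⟨x, hx.trans_le hst, h1.mono hst, Code.evaln_isSome_mono hst h2⟩

theorem levelSystem_programLevel (cU cA : Code) :
    LevelSystem (ProgramLevel cU cA) (RefutationAt cU cA) where
  lt := by
    rintro n x t ⟨p, -, -, h⟩
    exact h.lt
  mono := by
    rintro m n x t hmn ⟨p, hp, h⟩
    exact ⟨p, hp.trans_le (Nat.mul_le_mul_left 2 (Nat.pow_le_pow_right (by norm_num) hmn)), h⟩
  persist := by
    rintro n x t hD ⟨p, hp, h1, h2⟩
    exact ⟨p, hp, fun hd => hD ⟨p, hp, h1, hd⟩, h2.mono (Nat.le_succ t)⟩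
  die_mono := by
    rintro m n t hmn ⟨p, hp, h⟩
    exact ⟨p, hp.trans_le (Nat.mul_le_mul_left 2 (Nat.pow_le_pow_right (by norm_num) hmn)), h⟩
  die_count := by
    classical
    intro n s
    rw [Nat.count_eq_card_filter_range]
    -- Each of the 2 · 4^n programs becomes refuted at most once.
    have hsub : (Finset.range s).filter (RefutationAt cU cA n) ⊆
        (Finset.range (2 * 4 ^ n)).biUnion fun p => (Finset.range s).filter fun t =>
          ¬ Refuted cU cA p t ∧ Refuted cU cA p (t + 1) := by
      intro t ht
      obtain ⟨h1, p, hp, h2⟩ := Finset.mem_filter.1 ht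
      exact Finset.mem_biUnion.2 ⟨p, Finset.mem_range.2 hp, Finset.mem_filter.2 ⟨h1, h2⟩⟩
    refine (Finset.card_le_card hsub).trans
      ((Finset.card_biUnion_le_card_mul _ _ 1 fun p _ => ?_).trans (by simp))
    refine Finset.card_le_one.2 fun a ha b hb => ?_
    obtain ⟨-, ha1, ha2⟩ := Finset.mem_filter.1 ha
    obtain ⟨-, hb1, hb2⟩ := Finset.mem_filter.1 hb
    by_contra hne
    rcases lt_or_gt_of_ne hne with h | h
    · exact hb1 (ha2.mono h)
    · exact ha1 (hb2.mono h)

theorem primrecPred_rejects (cU : Code) :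
    PrimrecPred fun q : ℕ × ℕ × ℕ => Rejects cU q.1 q.2.1 q.2.2 :=
  Primrec.eq.comp (Code.primrec_evaln.comp (((Primrec.snd.comp .snd).pair (.const cU)).pair
    (Primrec₂.natPair.comp .fst (Primrec.fst.comp .snd)))) (.const _)

theorem primrecRel_refuted (cU cA : Code) : PrimrecRel (Refuted cU cA) := by
  refine PrimrecPred.exists_lt_of (R := fun (a : ℕ × ℕ) x => Rejects cU a.1 x a.2 ∧
    (cA.evaln a.2 x).isSome) Primrec.snd (.and ?_ ?_)
  · exact (primrecPred_rejects cU).comp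
      ((Primrec.fst.comp .fst).pair (Primrec.snd.pair (Primrec.snd.comp .fst)))
  · exact (Code.primrecPred_evaln_isSome cA).comp ((Primrec.snd.comp .fst).pair .snd)

theorem primrecPred_programLevel (cU cA : Code) :
    PrimrecPred fun q : ℕ × ℕ × ℕ => ProgramLevel cU cA q.1 q.2.1 q.2.2 := by
  refine PrimrecPred.exists_lt_of (Primrec.nat_mul.comp (.const 2) (Primrec.four_pow .fst))
    (.and (.not ?_) ?_)
  · exact (primrecRel_refuted cU cA).comp .snd (Primrec.snd.comp (Primrec.snd.comp .fst))
  · exact (primrecPred_rejects cU).comp (Primrec.snd.pair ((Primrec.fst.comp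
      (Primrec.snd.comp .fst)).pair (Primrec.snd.comp (Primrec.snd.comp .fst))))

theorem primrecRel_refutationAt (cU cA : Code) : PrimrecRel (RefutationAt cU cA) := by
  refine PrimrecPred.exists_lt_of (R := fun (a : ℕ × ℕ) p => ¬ Refuted cU cA p a.2 ∧
    Refuted cU cA p (a.2 + 1)) (Primrec.nat_mul.comp (.const 2) (Primrec.four_pow .fst))
    (.and (.not ?_) ?_)
  · exact (primrecRel_refuted cU cA).comp .snd (Primrec.snd.comp .fst)
  · exact (primrecRel_refuted cU cA).comp .snd (Primrec.succ.comp (Primrec.snd.comp .fst))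

/-- Once x is seen in A, every program seen to reject x is refuted by x itself. -/
theorem notMem_of_lasting (hA : ∀ x, x ∈ A ↔ (cA.eval x).Dom) {n x : ℕ}
    (h : LevelSystem.Lasting (ProgramLevel cU cA) n x) : x ∉ A := by
  intro hx
  obtain ⟨s, hs⟩ := Code.eval_dom_iff.1 ((hA x).1 hx)
  obtain ⟨t, ⟨p, -, h1, h2⟩, hst⟩ := (h.and (eventually_ge_atTop s)).exists
  exact h1 ⟨x, h2.lt, h2, Code.evaln_isSome_mono hst hs⟩

/-- A consistent program is never refuted. Totality plays no role, which is why the argument reaches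
the weak complexity. -/
theorem lasting_of_weakInstComplexity_lt {U : Interp}
    (hcU : ∀ p x v, Encodable.encode v ∈ cU.eval (Nat.pair p x) ↔ v ∈ U (natStr p) (natStr x))
    (hA : ∀ x, x ∈ A ↔ (cA.eval x).Dom) {n x : ℕ} (hx : x ∉ A)
    (h : weakInstComplexity U (strNat ⁻¹' A) (natStr x) < ((2 * n + 1 : ℕ) : ℕ∞)) :
    LevelSystem.Lasting (ProgramLevel cU cA) n x := by
  unfold weakInstComplexity at h
  simp only [iInf_lt_iff] at h
  obtain ⟨p, ⟨hcons, hp⟩, hlen⟩ := h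
  rw [Nat.cast_lt] at hlen
  have hchar : charStr (strNat ⁻¹' A) (natStr x) = [false] := by simp [charStr, hx]
  rw [hchar, ← natStr_strNat p, ← hcU, Code.evaln_complete] at hp
  obtain ⟨s, hs⟩ := hp
  filter_upwards [eventually_ge_atTop s] with t ht
  refine ⟨strNat p, strNat_lt_of_length_le (by omega), ?_, Rejects.mono ht hs⟩
  rintro ⟨y, -, h1, h2⟩
  have h3 := (hcU _ _ _).1 (Code.evaln_sound h1)
  rw [natStr_strNat] at h3
  have hy : y ∈ A := (hA y).2 (Code.eval_dom_iff.2 ⟨t, h2⟩)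
  rcases hcons _ _ h3 with h4 | h4
  · simp [charStr, hy] at h4
  · simp at h4

/-- The interpreter printing, on a program of length `2 n + 8`, the selected element of level
`n + 1` with the given index. -/
noncomputable def selectionInterp (cU cA : Code) : Interp := fun p _ =>
  (Nat.rfindOpt fun t => (selected (ProgramLevel cU cA) (RefutationAt cU cA)
    ((p.length - 8) / 2) t)[strNat p + 1 - 2 ^ p.length]?).map fun y => some (natStr y)

theorem partrec_selectionInterp (cU cA : Code) : Partrec₂ (selectionInterp cU cA) := by
  refine Partrec.map (Partrec.rfindOpt (Primrec.to_comp ?_))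
    (Computable.option_some.comp (computable_natStr.comp Computable.snd))
  have hp : Primrec fun q : (List Bool × List Bool) × ℕ => q.1.1 := Primrec.fst.comp .fst
  have hl := Primrec.list_length.comp hp
  exact Primrec.list_getElem?.comp
    ((primrec_selected (primrecPred_programLevel cU cA) (primrecRel_refutationAt cU cA)).comp
      (Primrec.nat_div.comp (Primrec.nat_sub.comp hl (.const 8)) (.const 2)) .snd)
    (Primrec.nat_sub.comp (Primrec.succ.comp (primrec_strNat.comp hp)) (Primrec.two_pow hl))

theorem kolmogorov_selectionInterp_le {n t y : ℕ}
    (hy : y ∈ selected (ProgramLevel cU cA) (RefutationAt cU cA) n t) :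
    kolmogorov (selectionInterp cU cA) (natStr y) ≤ ((2 * n + 8 : ℕ) : ℕ∞) := by
  obtain ⟨i, hi, hiy⟩ := List.getElem_of_mem hy
  have hlen := (levelSystem_programLevel cU cA).length_selected_le n t
  -- The length of the program encodes n, and there are exactly 4^(n+4) strings of that length to
  -- serve as indices.
  have h4 : 4 ^ (n + 4) = 2 ^ (2 * n + 8) := by
    rw [show (4 : ℕ) = 2 ^ 2 by norm_num, ← pow_mul]; congr 1
  obtain ⟨w, hw, hwi⟩ := exists_length_strNat (l := 2 * n + 8) (i := i) (by omega)
  have hmem : some (natStr y) ∈ selectionInterp cU cA w [] := by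
    refine Part.mem_map _ ((Nat.rfindOpt_mono ?_).2 ⟨t, ?_⟩)
    · intro a s t hst ha
      obtain ⟨r, hr⟩ := LevelSystem.selected_prefix (K := ProgramLevel cU cA)
        (D := RefutationAt cU cA) (n := (w.length - 8) / 2) hst
      rw [Option.mem_def] at ha ⊢
      rw [← hr, List.getElem?_append_left (List.getElem?_eq_some_iff.1 ha).1]
      exact ha
    · rw [hwi, hw, show (2 * n + 8 - 8) / 2 = n by omega, Option.mem_def,
        List.getElem?_eq_some_iff]
      exact ⟨hi, hiy⟩
  rw [← hw]
  exact iInf₂_le w hmem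

theorem hasWeakHardInstances_of_isHyperhypersimple {U : Interp} (hU : IsOptimal U)
    (hA : IsHyperhypersimple A) : HasWeakHardInstances U (strNat ⁻¹' A) := by
  obtain ⟨cA, hcA⟩ := hA.1.exists_code_dom
  obtain ⟨cU, hcU⟩ : ∃ cU : Code, ∀ p x v,
      Encodable.encode v ∈ cU.eval (Nat.pair p x) ↔ v ∈ U (natStr p) (natStr x) := by
    have h : Partrec fun n : ℕ =>
        (U (natStr n.unpair.1) (natStr n.unpair.2)).map Encodable.encode := by
      refine Partrec.map (hU.1.comp
        (computable_natStr.comp (Computable.fst.comp Computable.unpair))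
        (computable_natStr.comp (Computable.snd.comp Computable.unpair))) ?_
      exact (Computable.encode.comp Computable.snd).to₂
    obtain ⟨c, hc⟩ := Code.exists_code.1 (Partrec.nat_iff.1 h)
    refine ⟨c, fun p x v => ?_⟩
    rw [hc]
    simp
  have hLS := levelSystem_programLevel cU cA
  obtain ⟨c, hc, -, -⟩ := hU.2 _ (partrec_selectionInterp cU cA)
  by_contra hno
  -- The constant c comes from optimality, and 8 from the length 2n + 8 of the selecting programs.
  have hfin : {x | kolmogorov U x ≤ weakInstComplexity U (strNat ⁻¹' A) x + (c + 8 : ℕ)}.Finite := by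
    by_contra hinf
    exact hno ⟨c + 8, hinf⟩
  set E := natStr ⁻¹' {x | kolmogorov U x ≤ weakInstComplexity U (strNat ⁻¹' A) x + (c + 8 : ℕ)}
    with hEdef
  have hE : E.Finite := hfin.preimage (Equiv.injective _).injOn
  have hlt : ∀ x ∉ E, weakInstComplexity U (strNat ⁻¹' A) (natStr x) + (c + 8 : ℕ) <
      kolmogorov U (natStr x) := fun x hx => not_le.1 hx
  have hsel : ∀ n t, ∀ x ∈ selected (ProgramLevel cU cA) (RefutationAt cU cA) n t, x ∉ E →
      LevelSystem.Lasting (ProgramLevel cU cA) (n + 1) x →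
      LevelSystem.Lasting (ProgramLevel cU cA) n x := by
    intro n t x hx hxE hl
    refine lasting_of_weakInstComplexity_lt hcU hcA (notMem_of_lasting hcA hl) ?_
    -- Otherwise the complexity of x would be above (2n + 1) + (c + 8) and at most 2n + 8 + c.
    by_contra hge
    have h1 := (hlt x hxE).trans_le ((hc _).trans
      (add_le_add_left (kolmogorov_selectionInterp_le hx) _))
    have h2 := (add_le_add_left (not_lt.1 hge) ((c + 8 : ℕ) : ℕ∞)).trans_lt h1
    rw [← Nat.cast_add, ← Nat.cast_add, Nat.cast_lt] at h2
    omega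
  have hinf : ∀ B, ∃ n, ∃ x ≥ B, LevelSystem.Lasting (ProgramLevel cU cA) n x := by
    intro B
    obtain ⟨x, ⟨hxA, hxE⟩, hxB⟩ := (hA.2.1.sdiff hE).exists_gt B
    have h1 := (le_self_add.trans_lt (hlt x hxE)).trans_le le_top
    obtain ⟨m, hm⟩ := ENat.ne_top_iff_exists.1 h1.ne
    refine ⟨m, x, hxB.le, lasting_of_weakInstComplexity_lt hcU hcA hxA ?_⟩
    rw [← hm, Nat.cast_lt]
    omega
  obtain ⟨k₀, hk₀⟩ := hLS.exists_forall_eventually_found hE hsel hinf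
  refine not_isHyperhypersimple_of_enumeration (A := A) (R := fun k t x =>
    LevelSystem.FirstFound (ProgramLevel cU cA) (RefutationAt cU cA) k₀ (k₀ + k) t x)
    (primrecPred_firstFound (primrecPred_programLevel cU cA) (primrecRel_refutationAt cU cA) k₀)
    ?_ ?_ ?_ hA
  · exact fun k => LevelSystem.firstFound_finite hLS (hk₀ (k₀ + k) (by omega))
  · exact fun j k t t' x hjk h1 h2 => LevelSystem.not_firstFound_of_lt hLS
      (by omega) (by omega : k₀ + j < k₀ + k) h1 h2
  · intro k
    obtain ⟨x, t, h1, h2⟩ := LevelSystem.exists_firstFound_lasting hLS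
      (show k₀ ≤ k₀ + k by omega) hk₀
    exact ⟨x, notMem_of_lasting hcA h2, t, h1⟩

theorem HasWeakHardInstances.hasHardInstances {U : Interp} {B : Set (List Bool)}
    (h : HasWeakHardInstances U B) : HasHardInstances U B := by
  obtain ⟨c, hc⟩ := h
  refine ⟨c, hc.mono ?_⟩
  intro x hx
  refine le_trans (show kolmogorov U x ≤ weakInstComplexity U B x + c from hx)
    (add_le_add_left ?_ _)
  exact le_iInf₂ fun p hp => iInf₂_le p hp.2

end

/-! ### Attempts, enumerations and cancellations -/

section
/-- The column of an attempt. -/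
def column (a : ℕ) : ℕ := a.unpair.1

open Classical in
/-- The least `v < s` seen in `S a` but not in `B` at stage `s`, or `s` if there is none. -/
noncomputable def leastCandidate (S : ℕ → ℕ → ℕ → Prop) (B : ℕ → ℕ → Prop) (a s : ℕ) : ℕ :=
  (List.range s).findIdx fun v => decide (S a v s ∧ ¬ B v s)

/-- The attempt is the first one of its column which is not cancelled. -/
def ActiveAttempt (C : List ℕ) (a : ℕ) : Prop :=
  a ∉ C ∧ ∀ m < a.unpair.2, Nat.pair (column a) m ∈ C

/-- All elements enumerated by column `n` are in `B`. -/
def ColumnDead (B : ℕ → ℕ → Prop) (E : List (ℕ × ℕ)) (n s : ℕ) : Prop :=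
  ∀ q ∈ E, column q.1 = n → B q.2 s

/-- The attempt handled at stage `s` acts: it is active, its column is dead and it has a
candidate. -/
def ActsAt (S : ℕ → ℕ → ℕ → Prop) (B : ℕ → ℕ → Prop) (s : ℕ) (σ : List (ℕ × ℕ) × List ℕ) : Prop :=
  ActiveAttempt σ.2 s.unpair.1 ∧ ColumnDead B σ.1 (column s.unpair.1) s ∧
    leastCandidate S B s.unpair.1 s < s

open Classical in
/-- One stage of the construction; the state consists of the list of enumerations
`(attempt, element)` and the list of cancelled attempts. -/
noncomputable def attemptStep (S : ℕ → ℕ → ℕ → Prop) (B : ℕ → ℕ → Prop) (s : ℕ)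
    (σ : List (ℕ × ℕ) × List ℕ) : List (ℕ × ℕ) × List ℕ :=
  if ActsAt S B s σ then
    if ∃ q ∈ σ.1, q.2 = leastCandidate S B s.unpair.1 s ∧ column q.1 ≤ column s.unpair.1 then
      (σ.1, s.unpair.1 :: σ.2)
    else if ∃ q ∈ σ.1, q.2 = leastCandidate S B s.unpair.1 s then
      (σ.1, (σ.1.filter fun q => q.2 = leastCandidate S B s.unpair.1 s).map Prod.fst ++ σ.2)
    else ((s.unpair.1, leastCandidate S B s.unpair.1 s) :: σ.1, σ.2)
  else σ

/-- The state of the construction before stage `s`. -/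
noncomputable def attemptState (S : ℕ → ℕ → ℕ → Prop) (B : ℕ → ℕ → Prop) (s : ℕ) :
    List (ℕ × ℕ) × List ℕ :=
  Nat.rec ([], []) (fun s σ => attemptStep S B s σ) s

variable {S : ℕ → ℕ → ℕ → Prop} {B : ℕ → ℕ → Prop}

theorem attemptState_succ (s : ℕ) :
    attemptState S B (s + 1) = attemptStep S B s (attemptState S B s) := rfl

theorem leastCandidate_spec {a s : ℕ} (h : leastCandidate S B a s < s) :
    S a (leastCandidate S B a s) s ∧ ¬ B (leastCandidate S B a s) s := by
  classical
  have := List.findIdx_getElem (xs := List.range s)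
    (p := fun v => decide (S a v s ∧ ¬ B v s)) (w := by rw [List.length_range]; exact h)
  simp only [List.getElem_range, decide_eq_true_eq] at this
  exact this

theorem leastCandidate_le {a s v : ℕ} (h1 : S a v s) (h2 : ¬ B v s) :
    leastCandidate S B a s ≤ v := by
  classical
  by_contra hlt
  have := List.not_of_lt_findIdx (xs := List.range s)
    (p := fun v => decide (S a v s ∧ ¬ B v s)) (not_le.1 hlt)
  simp [h1, h2] at this

theorem mem_enumerated_succ {s : ℕ} {q : ℕ × ℕ} (hq : q ∈ (attemptState S B (s + 1)).1) :
    q ∈ (attemptState S B s).1 ∨ ActsAt S B s (attemptState S B s) ∧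
      q = (s.unpair.1, leastCandidate S B s.unpair.1 s) ∧
      ∀ q' ∈ (attemptState S B s).1, q'.2 ≠ leastCandidate S B s.unpair.1 s := by
  rw [attemptState_succ, attemptStep] at hq
  split_ifs at hq with h1 h2 h3
  · exact Or.inl hq
  · exact Or.inl hq
  · rcases List.mem_cons.1 hq with rfl | hq
    · exact Or.inr ⟨h1, rfl, fun q' hq' he => h3 ⟨q', hq', he⟩⟩
    · exact Or.inl hq
  · exact Or.inl hq

theorem mem_cancelled_succ {s b : ℕ} (hb : b ∈ (attemptState S B (s + 1)).2) :
    b ∈ (attemptState S B s).2 ∨ ActsAt S B s (attemptState S B s) ∧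
      (b = s.unpair.1 ∧ (∃ q ∈ (attemptState S B s).1,
          q.2 = leastCandidate S B s.unpair.1 s ∧ column q.1 ≤ column s.unpair.1) ∨
        column s.unpair.1 < column b) := by
  rw [attemptState_succ, attemptStep] at hb
  split_ifs at hb with h1 h2 h3
  · rcases List.mem_cons.1 hb with rfl | hb
    · exact Or.inr ⟨h1, Or.inl ⟨rfl, h2⟩⟩
    · exact Or.inl hb
  · rcases List.mem_append.1 hb with hb | hb
    · obtain ⟨q, hq, rfl⟩ := List.mem_map.1 hb
      rw [List.mem_filter, decide_eq_true_eq] at hq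
      exact Or.inr ⟨h1, Or.inr (not_le.1 fun hle => h2 ⟨q, hq.1, hq.2, hle⟩)⟩
    · exact Or.inl hb
  · exact Or.inl hb
  · exact Or.inl hb

theorem act_succ {s : ℕ} (h : ActsAt S B s (attemptState S B s)) :
    s.unpair.1 ∈ (attemptState S B (s + 1)).2 ∨
      (∃ b, (b, leastCandidate S B s.unpair.1 s) ∈ (attemptState S B s).1 ∧
        b ∈ (attemptState S B (s + 1)).2) ∨
      (s.unpair.1, leastCandidate S B s.unpair.1 s) ∈ (attemptState S B (s + 1)).1 := by
  rw [attemptState_succ, attemptStep, if_pos h]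
  split_ifs with h2 h3
  · exact Or.inl List.mem_cons_self
  · obtain ⟨⟨b, v⟩, hq, hv⟩ := h3
    simp only at hv
    refine Or.inr (Or.inl ⟨b, hv ▸ hq, List.mem_append_left _ (List.mem_map.2 ⟨(b, v), ?_, rfl⟩)⟩)
    rw [List.mem_filter, decide_eq_true_eq]
    exact ⟨hq, hv⟩
  · exact Or.inr (Or.inr List.mem_cons_self)

theorem state_subset_succ (s : ℕ) :
    (attemptState S B s).1 ⊆ (attemptState S B (s + 1)).1 ∧
      (attemptState S B s).2 ⊆ (attemptState S B (s + 1)).2 := by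
  rw [attemptState_succ, attemptStep]
  split_ifs <;> simp

theorem enumerated_mono {s t : ℕ} (hst : s ≤ t) :
    (attemptState S B s).1 ⊆ (attemptState S B t).1 := by
  induction t, hst using Nat.le_induction with
  | base => exact List.Subset.refl _
  | succ t _ ih => exact List.Subset.trans ih (state_subset_succ t).1

theorem cancelled_mono {s t : ℕ} (hst : s ≤ t) :
    (attemptState S B s).2 ⊆ (attemptState S B t).2 := by
  induction t, hst using Nat.le_induction with
  | base => exact List.Subset.refl _
  | succ t _ ih => exact List.Subset.trans ih (state_subset_succ t).2

theorem exists_seen_of_mem_enumerated {s : ℕ} {q : ℕ × ℕ} (hq : q ∈ (attemptState S B s).1) :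
    ∃ t, S q.1 q.2 t := by
  induction s with
  | zero => simp [attemptState] at hq
  | succ s ih =>
    rcases mem_enumerated_succ hq with hq | ⟨h1, rfl, -⟩
    · exact ih hq
    · exact ⟨s, (leastCandidate_spec h1.2.2).1⟩

/-- An element is enumerated only if no attempt has enumerated it before; this makes the columns
disjoint. -/
theorem enumerated_unique {s : ℕ} {q q' : ℕ × ℕ} (hq : q ∈ (attemptState S B s).1)
    (hq' : q' ∈ (attemptState S B s).1) (h : q.2 = q'.2) : q = q' := by
  induction s with
  | zero => simp [attemptState] at hq
  | succ s ih =>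
    rcases mem_enumerated_succ hq with hq | ⟨-, rfl, h1⟩ <;>
      rcases mem_enumerated_succ hq' with hq' | ⟨-, rfl, h2⟩
    · exact ih hq hq'
    · exact absurd h (h2 q hq)
    · exact absurd h.symm (h1 q' hq')
    · rfl

/-- A column enumerates only when all its earlier elements have entered B. -/
theorem column_alive_unique (hB : ∀ v s t, s ≤ t → B v s → B v t) {s : ℕ} {q q' : ℕ × ℕ}
    (hq : q ∈ (attemptState S B s).1) (hq' : q' ∈ (attemptState S B s).1)
    (h : column q.1 = column q'.1) (h1 : ¬ B q.2 s) (h2 : ¬ B q'.2 s) : q = q' := by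
  induction s with
  | zero => simp [attemptState] at hq
  | succ s ih =>
    have h1' := fun hb => h1 (hB _ s (s + 1) (Nat.le_succ s) hb)
    have h2' := fun hb => h2 (hB _ s (s + 1) (Nat.le_succ s) hb)
    rcases mem_enumerated_succ hq with hq | ⟨ha, rfl, -⟩ <;>
      rcases mem_enumerated_succ hq' with hq' | ⟨ha', rfl, -⟩
    · exact ih hq hq' h1' h2'
    · exact absurd (ha'.2.1 q hq h) h1'
    · exact absurd (ha.2.1 q' hq' h.symm) h2'
    · rfl

theorem activeAttempt_unique {C : List ℕ} {a b : ℕ} (ha : ActiveAttempt C a)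
    (hb : ActiveAttempt C b) (h : column a = column b) : a = b := by
  have key : ∀ {a b : ℕ}, ActiveAttempt C a → ActiveAttempt C b → column a = column b →
      ¬ a.unpair.2 < b.unpair.2 := by
    intro a b ha hb h hlt
    have := hb.2 _ hlt
    rw [← h, column, Nat.pair_unpair] at this
    exact ha.1 this
  rw [← Nat.pair_unpair a, ← Nat.pair_unpair b]
  have h1 := key ha hb h
  have h2 := key hb ha h.symm
  unfold column at h
  rw [h, show a.unpair.2 = b.unpair.2 by omega]

theorem exists_activeAttempt (C : List ℕ) (n : ℕ) : ∃ a, column a = n ∧ ActiveAttempt C a := by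
  classical
  have hex : ∃ m, Nat.pair n m ∉ C := by
    by_contra hno
    push Not at hno
    have hinj : Function.Injective (Nat.pair n) := fun a b h => (Nat.pair_eq_pair.1 h).2
    exact (Set.infinite_range_of_injective hinj)
      (C.toFinset.finite_toSet.subset (by rintro _ ⟨m, rfl⟩; simpa using hno m))
  refine ⟨Nat.pair n (Nat.find hex), by simp [column], Nat.find_spec hex, fun m hm => ?_⟩
  rw [Nat.unpair_pair] at hm
  have := Nat.find_min hex hm
  simpa [column] using this

/-- Column `n` enumerates an element outside `A`. -/
def ColumnSucceeds (S : ℕ → ℕ → ℕ → Prop) (B : ℕ → ℕ → Prop) (A : Set ℕ) (n : ℕ) : Prop :=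
  ∃ q : ℕ × ℕ, column q.1 = n ∧ q.2 ∉ A ∧ ∃ s, q ∈ (attemptState S B s).1

variable {A : Set ℕ}

theorem not_actsAt_of_alive (hBA : ∀ v, v ∈ A ↔ ∃ s, B v s) {q : ℕ × ℕ} (hq : q.2 ∉ A) {s t : ℕ}
    (hst : s ≤ t) (hs : q ∈ (attemptState S B s).1) (hcol : column q.1 = column t.unpair.1) :
    ¬ ActsAt S B t (attemptState S B t) :=
  fun h => hq ((hBA _).2 ⟨t, h.2.1 q (enumerated_mono hst hs) hcol⟩)

/-- Once the lower columns hold elements outside A they never act again, and column n loses no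
further attempts. Its active attempt is then permanent, so `hcancel` supplies an element of its set
outside A. -/
theorem columnSucceeds (hS : ∀ a v s t, s ≤ t → S a v s → S a v t)
    (hB : ∀ v s t, s ≤ t → B v s → B v t) (hBA : ∀ v, v ∈ A ↔ ∃ s, B v s)
    (hcancel : ∀ a, (∃ s, a ∈ (attemptState S B s).2) ↔ ∀ v s, S a v s → v ∈ A) (n : ℕ) :
    ColumnSucceeds S B A n := by
  induction n using Nat.strong_induction_on with
  | _ n ih =>
    have hs₀ : ∃ s₀, ∀ j < n, ∃ q : ℕ × ℕ, column q.1 = j ∧ q.2 ∉ A ∧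
        q ∈ (attemptState S B s₀).1 := by
      choose! q hq1 hq2 s hs using ih
      refine ⟨(Finset.range n).sup s, fun j hj => ⟨q j, hq1 j hj, hq2 j hj, ?_⟩⟩
      exact enumerated_mono (Finset.le_sup (Finset.mem_range.2 hj)) (hs j hj)
    obtain ⟨s₀, hs₀⟩ := hs₀
    have hlow : ∀ s ≥ s₀, ActsAt S B s (attemptState S B s) → n ≤ column s.unpair.1 := by
      intro s hs hact
      by_contra hlt
      obtain ⟨q, hq1, hq2, hq3⟩ := hs₀ _ (not_le.1 hlt)
      exact not_actsAt_of_alive hBA hq2 hs hq3 hq1 hact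
    have hstable : ∀ s ≥ s₀, ∀ b, column b = n → b ∈ (attemptState S B s).2 →
        b ∈ (attemptState S B s₀).2 := by
      intro s hs b hb
      induction s, hs using Nat.le_induction with
      | base => exact id
      | succ s hs ihs =>
        intro hbs
        rcases mem_cancelled_succ hbs with hbs' | ⟨hact, ⟨hba, q, hq, hqv, hqc⟩ | hlt⟩
        · exact ihs hbs'
        -- The cancellation of b forces the candidate into A, where it has not yet been seen. It
        -- cannot come from column n, which is dead, nor from a lower column, whose only element not
        -- yet in B lies outside A.
        · exfalso
          obtain ⟨hv1, hv2⟩ := leastCandidate_spec hact.2.2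
          have hvA := (hcancel b).1 ⟨_, hbs⟩ _ s (by rw [hba]; exact hv1)
          rw [← hqv] at hv2 hvA
          have hqn : column q.1 < n := by
            refine lt_of_le_of_ne (hqc.trans_eq (hba ▸ hb)) fun he => hv2 (hact.2.1 q hq ?_)
            rw [he, ← hb, hba]
          obtain ⟨q', h1, h2, h3⟩ := hs₀ _ hqn
          have := column_alive_unique hB hq (enumerated_mono hs h3) h1.symm hv2
            fun hb' => h2 ((hBA _).2 ⟨s, hb'⟩)
          exact h2 (this ▸ hvA)
        · have := hlow s hs hact
          omega
    obtain ⟨a, han, hact₀⟩ := exists_activeAttempt (attemptState S B s₀).2 n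
    have hactive : ∀ s ≥ s₀, ActiveAttempt (attemptState S B s).2 a := fun s hs =>
      ⟨fun h => hact₀.1 (hstable s hs a han h), fun m hm => cancelled_mono hs (hact₀.2 m hm)⟩
    have hnever : ∀ s, a ∉ (attemptState S B s).2 := fun s h =>
      (hactive (max s s₀) (le_max_right _ _)).1 (cancelled_mono (le_max_left _ _) h)
    obtain ⟨w, r, hw, hwA⟩ : ∃ v s, S a v s ∧ v ∉ A := by
      by_contra hno
      push Not at hno
      obtain ⟨s, hs⟩ := (hcancel a).2 hno
      exact hnever s hs
    have hBev : ∀ v ∈ A, ∀ᶠ t in atTop, B v t := by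
      intro v hv
      obtain ⟨s, hs⟩ := (hBA v).1 hv
      exact eventually_atTop.2 ⟨s, fun t ht => hB v s t ht hs⟩
    -- When all elements of A below w have been seen, the least candidate is at most w and cannot
    -- belong to A.
    have hsmall : ∀ᶠ t in atTop, ∀ v ∈ Finset.range w, v ∈ A → B v t := by
      refine (Finset.eventually_all _).2 fun v _ => ?_
      by_cases hv : v ∈ A
      · exact (hBev v hv).mono fun t ht _ => ht
      · exact Eventually.of_forall fun t h => absurd h hv
    obtain ⟨s₁, hs₁⟩ := eventually_atTop.1 (hsmall.and ((eventually_ge_atTop s₀).and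
      ((eventually_ge_atTop r).and (eventually_gt_atTop w))))
    have hsucc : ∀ s ≥ s₁, s.unpair.1 = a → ColumnDead B (attemptState S B s).1 n s →
        ColumnSucceeds S B A n := by
      intro s hs hsa hdead
      obtain ⟨h1, h2, h3, h4⟩ := hs₁ s hs
      have hle := leastCandidate_le (B := B) (hS _ _ _ _ h3 hw)
        fun hb => hwA ((hBA w).2 ⟨s, hb⟩)
      have hlt : leastCandidate S B a s < s := by omega
      obtain ⟨hv1, hv2⟩ := leastCandidate_spec hlt
      have hvA : leastCandidate S B a s ∉ A := by
        intro hv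
        rcases hle.lt_or_eq with hlt' | heq
        · exact hv2 (h1 _ (Finset.mem_range.2 hlt') hv)
        · exact hwA (heq ▸ hv)
      have hact : ActsAt S B s (attemptState S B s) := by
        refine ⟨?_, ?_, ?_⟩ <;> rw [hsa]
        · exact hactive s h2
        · rwa [han]
        · exact hlt
      -- The attempt a is never cancelled, and cancelling an attempt that enumerated the candidate
      -- would force it into A; so the candidate is enumerated.
      rcases act_succ hact with h5 | ⟨b, hb1, hb2⟩ | h5
      · exact absurd (hsa ▸ h5) (hnever _)
      · rw [hsa] at hb1
        obtain ⟨t, ht⟩ := exists_seen_of_mem_enumerated hb1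
        exact absurd ((hcancel b).1 ⟨_, hb2⟩ _ t ht) hvA
      · rw [hsa] at h5
        exact ⟨_, han, hvA, _, h5⟩
    by_contra hfail
    have hfreeze : ∀ s ≥ s₁, ∀ q ∈ (attemptState S B s).1, column q.1 = n →
        q ∈ (attemptState S B s₁).1 := by
      intro s hs q hq hqn
      induction s, hs using Nat.le_induction with
      | base => exact hq
      | succ s hs ihs =>
        rcases mem_enumerated_succ hq with hq | ⟨hact, rfl, -⟩
        · exact ihs hq
        · exfalso
          simp only at hqn
          have hsa := activeAttempt_unique hact.1 (hactive s (hs₁ s hs).2.1) (hqn.trans han.symm)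
          exact hfail (hsucc s hs hsa (hqn ▸ hact.2.1))
    have hdead : ∀ᶠ t in atTop, ∀ q ∈ (attemptState S B s₁).1.toFinset, column q.1 = n → B q.2 t := by
      refine (Finset.eventually_all _).2 fun q hq => ?_
      by_cases hqn : column q.1 = n
      · have hqA : q.2 ∈ A := by
          by_contra hqA
          exact hfail ⟨q, hqn, hqA, s₁, List.mem_toFinset.1 hq⟩
        exact (hBev _ hqA).mono fun t ht _ => ht
      · exact Eventually.of_forall fun t h => absurd h hqn
    obtain ⟨T, hT⟩ := eventually_atTop.1 (hdead.and (eventually_ge_atTop s₁))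
    -- The stage coded by a and T is late enough and handles the attempt a.
    have hge : T ≤ Nat.pair a T := Nat.right_le_pair a T
    obtain ⟨h1, h2⟩ := hT _ hge
    refine hfail (hsucc _ h2 (by simp) fun q hq hqn => ?_)
    exact h1 q (List.mem_toFinset.2 (hfreeze _ h2 q hq hqn)) hqn

/-- A column holding an element outside A is never dead again and stops acting. -/
theorem column_enumeration_finite (hBA : ∀ v, v ∈ A ↔ ∃ s, B v s) {n : ℕ}
    (h : ColumnSucceeds S B A n) :
    {v | ∃ s, ∃ q ∈ (attemptState S B s).1, q.2 = v ∧ column q.1 = n}.Finite := by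
  obtain ⟨q₀, hcol, hA, s₀, hq₀⟩ := h
  refine (((attemptState S B s₀).1.map Prod.snd).toFinset.finite_toSet).subset ?_
  rintro v ⟨s, q, hq, rfl, hqn⟩
  have key : ∀ s ≥ s₀, q ∈ (attemptState S B s).1 → q ∈ (attemptState S B s₀).1 := by
    intro s hs hq
    induction s, hs using Nat.le_induction with
    | base => exact hq
    | succ s hs ihs =>
      rcases mem_enumerated_succ hq with hq | ⟨hact, rfl, -⟩
      · exact ihs hq
      · exact absurd hact (not_actsAt_of_alive hBA hA hs hq₀ (hcol.trans hqn.symm))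
  have := key (max s s₀) (le_max_right _ _) (enumerated_mono (le_max_left _ _) hq)
  simp only [List.coe_toFinset, List.mem_map]
  exact ⟨q, this, rfl⟩

end

/-! ### Computability of the construction and the recursion theorem -/

theorem primrec_column : Primrec column := Primrec.fst.comp Primrec.unpair

/-- Uniformity in p lets the recursion theorem run the construction on the sets determined by its
own code. -/
theorem primrec_attemptState {S : ℕ → ℕ → ℕ → ℕ → Prop} {B : ℕ → ℕ → Prop}
    (hS : PrimrecPred fun q : ℕ × ℕ × ℕ × ℕ => S q.1 q.2.1 q.2.2.1 q.2.2.2) (hB : PrimrecRel B) :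
    Primrec₂ fun p s => attemptState (S p) B s := by
  classical
  let X := ℕ × ℕ × List (ℕ × ℕ) × List ℕ
  have hp : Primrec fun x : X => x.1 := Primrec.fst
  have hs : Primrec fun x : X => x.2.1 := Primrec.fst.comp .snd
  have hE : Primrec fun x : X => x.2.2.1 := Primrec.fst.comp (Primrec.snd.comp .snd)
  have hC : Primrec fun x : X => x.2.2.2 := Primrec.snd.comp (Primrec.snd.comp .snd)
  have ha : Primrec fun x : X => x.2.1.unpair.1 := Primrec.fst.comp (Primrec.unpair.comp hs)
  have hn : Primrec fun x : X => column x.2.1.unpair.1 := primrec_column.comp ha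
  have hv : Primrec fun x : X => leastCandidate (S x.1) B x.2.1.unpair.1 x.2.1 := by
    refine Primrec.list_findIdx (Primrec.list_range.comp hs) (PrimrecPred.decide (.and ?_ (.not ?_)))
    · exact hS.comp ((hp.comp .fst).pair ((ha.comp .fst).pair (Primrec.snd.pair (hs.comp .fst))))
    · exact hB.comp .snd (hs.comp .fst)
  have hmem : PrimrecRel fun (b : ℕ) (C : List ℕ) => b ∈ C :=
    (PrimrecRel.exists_mem_list (Primrec.eq (α := ℕ))).swap.of_eq fun b C => by
      simp [Function.swap]
  have hactive : PrimrecPred fun x : X => ActiveAttempt x.2.2.2 x.2.1.unpair.1 := by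
    refine .and (.not (hmem.comp ha hC))
      (PrimrecPred.forall_lt_of (Primrec.snd.comp (Primrec.unpair.comp ha)) ?_)
    exact hmem.comp (Primrec₂.natPair.comp (hn.comp .fst) .snd) (hC.comp .fst)
  have hdead : PrimrecPred fun x : X => ColumnDead B x.2.2.1 (column x.2.1.unpair.1) x.2.1 := by
    have h : PrimrecRel fun (E : List (ℕ × ℕ)) (x : X) =>
        ∀ q ∈ E, ¬ column q.1 = column x.2.1.unpair.1 ∨ B q.2 x.2.1 := by
      refine PrimrecRel.forall_mem_list (.or (.not ?_) ?_)
      · exact Primrec.eq.comp (primrec_column.comp (Primrec.fst.comp .fst)) (hn.comp .snd)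
      · exact hB.comp (Primrec.snd.comp .fst) (hs.comp .snd)
    exact (h.comp hE .id).of_eq fun x => forall₂_congr fun q _ => imp_iff_not_or.symm
  have hacts : PrimrecPred fun x : X => ActsAt (S x.1) B x.2.1 x.2.2 :=
    .and hactive (.and hdead (Primrec.nat_lt.comp hv hs))
  have hlow : PrimrecPred fun x : X => ∃ q ∈ x.2.2.1,
      q.2 = leastCandidate (S x.1) B x.2.1.unpair.1 x.2.1 ∧
        column q.1 ≤ column x.2.1.unpair.1 := by
    have h : PrimrecRel fun (E : List (ℕ × ℕ)) (x : X) => ∃ q ∈ E,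
        q.2 = leastCandidate (S x.1) B x.2.1.unpair.1 x.2.1 ∧
          column q.1 ≤ column x.2.1.unpair.1 := by
      refine PrimrecRel.exists_mem_list (.and ?_ ?_)
      · exact Primrec.eq.comp (Primrec.snd.comp .fst) (hv.comp .snd)
      · exact Primrec.nat_le.comp (primrec_column.comp (Primrec.fst.comp .fst)) (hn.comp .snd)
    exact h.comp hE .id
  have hsame : PrimrecRel fun (q : ℕ × ℕ) (v : ℕ) => q.2 = v :=
    Primrec.eq.comp (Primrec.snd.comp .fst) .snd
  have hany : PrimrecPred fun x : X => ∃ q ∈ x.2.2.1,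
      q.2 = leastCandidate (S x.1) B x.2.1.unpair.1 x.2.1 := hsame.exists_mem_list.comp hE hv
  have hstep : Primrec₂ fun (p : ℕ) (q : ℕ × List (ℕ × ℕ) × List ℕ) =>
      attemptStep (S p) B q.1 q.2 := by
    refine Primrec.ite hacts (Primrec.ite hlow (hE.pair (Primrec.list_cons.comp ha hC))
      (Primrec.ite hany (hE.pair (Primrec.list_append.comp (Primrec.list_map
        (hsame.listFilter.comp hE hv) (Primrec.fst.comp Primrec.snd).to₂) hC))
        ((Primrec.list_cons.comp (ha.pair hv) hE).pair hC))) (Primrec.snd.comp .snd)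
  exact Primrec.nat_rec (f := fun _ : ℕ => (([], []) : List (ℕ × ℕ) × List ℕ)) (.const _) hstep

open Nat.Partrec (Code) in
theorem not_isQComplete_of_isHyperhypersimple {A : Set ℕ} (hA : IsHyperhypersimple A) :
    ¬ IsQComplete A := by
  classical
  rintro ⟨hre, g, hg, hQ⟩
  obtain ⟨cA, hcA⟩ := hre.exists_code_dom
  obtain ⟨cT, hcT⟩ : ∃ cT : Code, ∀ (c : Code) (a v : ℕ),
      cT.eval (Nat.pair (Encodable.encode c) (Nat.pair a v)) =
        (Denumerable.ofNat Code (g (Encodable.encode (c.curry a)))).eval v := by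
    have h : Partrec fun n : ℕ => (Denumerable.ofNat Code (g (Encodable.encode
        ((Denumerable.ofNat Code n.unpair.1).curry n.unpair.2.unpair.1)))).eval
          n.unpair.2.unpair.2 := by
      have hu : Primrec fun n : ℕ => n.unpair.2.unpair :=
        Primrec.unpair.comp (Primrec.snd.comp Primrec.unpair)
      refine Code.eval_part.comp ((Computable.ofNat Code).comp (hg.comp (Primrec.to_comp ?_)))
        (Primrec.snd.comp hu).to_comp
      exact Primrec.encode.comp (Code.primrec₂_curry.comp
        ((Primrec.ofNat Code).comp (Primrec.fst.comp Primrec.unpair)) (Primrec.fst.comp hu))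
    obtain ⟨cT, hc⟩ := Code.exists_code.1 (Partrec.nat_iff.1 h)
    refine ⟨cT, fun c a v => ?_⟩
    rw [hc]
    simp
  let S : ℕ → ℕ → ℕ → ℕ → Prop := fun p a v s =>
    (cT.evaln s (Nat.pair p (Nat.pair a v))).isSome = true
  let B : ℕ → ℕ → Prop := fun v s => (cA.evaln s v).isSome = true
  have hSp : PrimrecPred fun q : ℕ × ℕ × ℕ × ℕ => S q.1 q.2.1 q.2.2.1 q.2.2.2 := by
    have h2 : Primrec fun q : ℕ × ℕ × ℕ × ℕ => q.2.2 := Primrec.snd.comp .snd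
    exact (Code.primrecPred_evaln_isSome cT).comp ((Primrec.snd.comp h2).pair
      (Primrec₂.natPair.comp .fst (Primrec₂.natPair.comp (Primrec.fst.comp .snd)
        (Primrec.fst.comp h2))))
  have hBp : PrimrecRel B := (Code.primrecPred_evaln_isSome cA).comp (Primrec.snd.pair .fst)
  have hstate := primrec_attemptState hSp hBp
  have hmem : PrimrecRel fun (b : ℕ) (C : List ℕ) => b ∈ C :=
    (PrimrecRel.exists_mem_list (Primrec.eq (α := ℕ))).swap.of_eq fun b C => by
      simp [Function.swap]
  have hcancelled : PrimrecRel fun (x : Code × ℕ) (s : ℕ) =>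
      x.2.unpair.1 ∈ (attemptState (S (Encodable.encode x.1)) B s).2 :=
    hmem.comp (Primrec.fst.comp (Primrec.unpair.comp (Primrec.snd.comp .fst)))
      (Primrec.snd.comp (hstate.comp (Primrec.encode.comp (Primrec.fst.comp .fst)) .snd))
  have hf : Partrec₂ fun (c : Code) (n : ℕ) => Nat.rfind fun s => Part.some
      (decide (n.unpair.1 ∈ (attemptState (S (Encodable.encode c)) B s).2)) :=
    Partrec.rfind (p := fun (x : Code × ℕ) s => Part.some
      (decide (x.2.unpair.1 ∈ (attemptState (S (Encodable.encode x.1)) B s).2)))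
      (Computable₂.partrec₂ hcancelled.decide.to_comp)
  -- The code c searches for the cancellation of an attempt in the construction built from c itself.
  -- It ignores the second component of its input, so `c.curry a` halts on its own index exactly
  -- when a is cancelled.
  obtain ⟨c, hc⟩ := Code.fixed_point₂ hf
  set T := S (Encodable.encode c) with hT
  have hseen : ∀ a v, v ∈ reSet (g (Encodable.encode (c.curry a))) ↔ ∃ s, T a v s := by
    intro a v
    change (Code.eval _ v).Dom ↔ _
    rw [← hcT, Code.eval_dom_iff]
  have hcancel : ∀ a, (∃ s, a ∈ (attemptState T B s).2) ↔ ∀ v s, T a v s → v ∈ A := by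
    intro a
    have h1 : Encodable.encode (c.curry a) ∈ haltingSet ↔ ∃ s, a ∈ (attemptState T B s).2 := by
      change Encodable.encode (c.curry a) ∈ reSet (Encodable.encode (c.curry a)) ↔ _
      rw [mem_reSet_encode, Code.eval_curry, hc]
      simp only [Nat.unpair_pair]
      constructor
      · intro h
        exact ⟨_, by simpa using Nat.rfind_spec (Part.get_mem h)⟩
      · rintro ⟨s, hs⟩
        exact Nat.rfind_dom.2 ⟨s, by simpa using hs, fun _ => trivial⟩
    rw [← h1, hQ]
    constructor
    · exact fun h v s hv => h ((hseen a v).2 ⟨s, hv⟩)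
    · intro h v hv
      obtain ⟨s, hs⟩ := (hseen a v).1 hv
      exact h v s hs
  have hBA : ∀ v, v ∈ A ↔ ∃ s, B v s := fun v => (hcA v).trans Code.eval_dom_iff
  have hsucc := columnSucceeds (S := T) (B := B) (fun a v s t => Code.evaln_isSome_mono)
    (fun v s t => Code.evaln_isSome_mono) hBA hcancel
  refine not_isHyperhypersimple_of_enumeration (A := A) (R := fun k t x =>
    ∃ q ∈ (attemptState T B t).1, q.2 = x ∧ column q.1 = k) ?_ ?_ ?_ ?_ hA
  · have h : PrimrecRel fun (E : List (ℕ × ℕ)) (y : ℕ × ℕ × ℕ) =>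
        ∃ q ∈ E, q.2 = y.2.2 ∧ column q.1 = y.1 := by
      refine PrimrecRel.exists_mem_list (.and ?_ ?_)
      · exact Primrec.eq.comp (Primrec.snd.comp .fst)
          (Primrec.snd.comp (Primrec.snd.comp .snd))
      · exact Primrec.eq.comp (primrec_column.comp (Primrec.fst.comp .fst))
          (Primrec.fst.comp .snd)
    exact h.comp (Primrec.fst.comp (hstate.comp (.const _) (Primrec.fst.comp .snd))) .id
  · exact fun k => column_enumeration_finite hBA (hsucc k)
  · rintro j k t t' x hjk ⟨q, hq, h1, h2⟩ ⟨q', hq', h1', h2'⟩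
    have := enumerated_unique (enumerated_mono (le_max_left t t') hq)
      (enumerated_mono (le_max_right t t') hq') (h1.trans h1'.symm)
    rw [← h2, ← h2', this] at hjk
    exact lt_irrefl _ hjk
  · intro k
    obtain ⟨q, h1, h2, s, hs⟩ := hsucc k
    exact ⟨q.2, h2, s, q, hs, rfl, h1⟩

theorem mainTheorem7 (U : Interp) (hU : IsOptimal U) (A : Set ℕ) (hA : IsHyperhypersimple A) :
    HasWeakHardInstances U (strNat ⁻¹' A) ∧
      HasHardInstances U (strNat ⁻¹' A) ∧
      ¬ IsQComplete A :=
  have h := hasWeakHardInstances_of_isHyperhypersimple hU hA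
  ⟨h, h.hasHardInstances, not_isQComplete_of_isHyperhypersimple hA⟩
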